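/- A (finite, simple, undirected) graph is called Eulerian if it is connected and every vertex has even degree. A 2-switch on a graph $G=(V,E)$ is the operation of removing two edges of $E$ and adding two edges not in $E$, so that the result is a simple graph $G'=(V,E')$ with $|E'|=|E|$. Theorem. Let $G=(V,E)$ and $H=(V,F)$ be any two labeled Eulerian graphs on the same finite vertex set with $m=|E|=|F|$ edges. Then there is a sequence $(G=G_0,G_1,\dots,G_\ell=H)$ of labeled graphs on $V$ such that each $G_i$ is Eulerian and each $G_{i+1}$ can be obtained from $G_i$ by a 2-switch. In other words, for every finite vertex set $V$ with $n$ elements and every $m$ for which there is at least one Eulerian graph on $V$ with $m$ edges, the 2-switch graph of Eulerian graphs is connected; its vertices are the labeled Eulerian graphs on $V$ with $m$ edges, and two of them are adjacent if and only if they can be obtained from each other by a 2-switch. -/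

import Mathlib

/-- `IsSwitch k G G'`: the simple graph `G'` arises from `G`, on the same (labeled) vertex set, by a
`k`-switch: a set `R` of `k` edges of `G` is removed and a set `A` of `k` new edges, i.e. pairs that
are not edges of `G`, is added. (As `G'` is a simple graph, `A` contains no loops.) -/
def IsSwitch {V : Type*} (k : ℕ) (G G' : SimpleGraph V) : Prop :=
  ∃ R A : Finset (Sym2 V), R.card = k ∧ A.card = k ∧
    (R : Set (Sym2 V)) ⊆ G.edgeSet ∧ Disjoint (A : Set (Sym2 V)) G.edgeSet ∧
    G'.edgeSet = (G.edgeSet \ (R : Set (Sym2 V))) ∪ (A : Set (Sym2 V))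

open Classical in
/-- A finite simple graph is Eulerian if it is connected and all its degrees are even. -/
def IsEulerianGraph {V : Type*} [Fintype V] (G : SimpleGraph V) : Prop :=
  G.Connected ∧ ∀ v : V, Even (G.degree v)

open Classical in
/-- The number of edges of a finite simple graph. -/
noncomputable def numEdges {V : Type*} [Fintype V] (G : SimpleGraph V) : ℕ :=
  G.edgeFinset.card

theorem IsSwitch.symm {V : Type*} {k : ℕ} {G G' : SimpleGraph V} (h : IsSwitch k G G') :
    IsSwitch k G' G := by
  obtain ⟨R, A, hR, hA, hRG, hAG, hE⟩ := h
  refine ⟨A, R, hA, hR, ?_, ?_, ?_⟩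
  · rw [hE]; exact Set.subset_union_right
  · rw [hE, Set.disjoint_left]
    rintro e heR (he | heA)
    · exact he.2 heR
    · exact Set.disjoint_left.1 hAG heA (hRG heR)
  · rw [hE]
    ext e
    have h1 : e ∈ (R : Set (Sym2 V)) → e ∈ G.edgeSet := fun h => hRG h
    have h2 : e ∈ (A : Set (Sym2 V)) → e ∉ G.edgeSet := fun h => Set.disjoint_left.1 hAG h
    simp only [Set.mem_union, Set.mem_sdiff]
    tauto

theorem not_isSwitch_two_self {V : Type*} (G : SimpleGraph V) : ¬ IsSwitch 2 G G := by
  rintro ⟨R, A, _, hA, _, hAG, hE⟩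
  obtain ⟨e, he⟩ : A.Nonempty := Finset.card_pos.1 (by omega)
  refine Set.disjoint_left.1 hAG he ?_
  rw [hE]
  exact Or.inr he

/-- The 2-switch graph of Eulerian graphs: its vertices are the labeled Eulerian graphs on the
vertex set `V` with `m` edges, two of them being adjacent if and only if they can be obtained from
each other by a 2-switch. -/
def twoSwitchGraph (V : Type*) [Fintype V] (m : ℕ) :
    SimpleGraph {G : SimpleGraph V // IsEulerianGraph G ∧ numEdges G = m} where
  Adj G H := IsSwitch 2 G.1 H.1
  symm := ⟨fun _ _ h => h.symm⟩
  loopless := ⟨fun G h => not_isSwitch_two_self G.1 h⟩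

/-!
A 2-switch between two graphs with even degrees inverts the status of the four pairs of a
quadrilateral (`flipQuad`), two of which are edges. Inverting a triangle `a b u` of which only
`a b` is an edge (`flipTri`) replaces this edge by the path `a u b`; it keeps all degrees even, keeps
the graph connected, and adds one edge. This is called a subdivision of `a b` by `u`, although `u`
is allowed to be an old vertex (`Subdividable`). The theorem is proved by induction on the number
of edges, descending along subdivisions.

* An Eulerian graph that is neither a cycle nor complete is a subdivision of an Eulerian graph on
  the same vertices (`EulerianOn.exists_eq_flipTri`): a vertex `v` of degree at least four has
  neighbors `a`, `b` that are not adjacent to each other, and evenness of the degrees allows a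
  choice for which replacing `a v b` by `a b` does not disconnect `v`. There is only one complete
  graph. For cycles, a vertex is suppressed, and the induction is on the number of vertices
  (`EulerianOn.linked_of_numEdges_le`).
* All subdivisions of one graph `X` are linked by 2-switches (`EulerianOn.linked_flipTri`). In
  terms of the complement of `X` a subdivision is an induced path `a u b`. Two such paths in one
  component of the complement are joined by local changes along a path from one center to the
  other; if they are in different components, `X` has all edges between them and three explicit
  switches do it.
* A 2-switch from `X` to `X'` does not lead out of the class of the subdivisions, if both graphs
  have any (`Move.subdivisionsLinked`). If some triangle can be used for a subdivision in both
  graphs, the same 2-switch links the two subdivisions. Otherwise the adjacencies between the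
  quadrilateral and the remaining vertices are so restricted that a link can be given directly.
* The graphs without subdivisions are the complete multipartite ones. A chain of 2-switches may run
  through them, so it has to be seen that its class of subdivisions survives. All neighbors of a
  complete multipartite graph that have subdivisions have linked ones
  (`Move.sameSubdivisions_of_multipartite`), and two complete multipartite graphs that follow each
  other in a chain have neighbors with linked subdivisions (`Move.exists_sameSubdivisions`). Thus
  the invariant `LinkedAbove` is passed along the chain, and `Linked.flipTri` lifts it one edge up.
-/

open scoped symmDiff

/-! ### Flips of triangles and quadrilaterals -/

section Flips
variable {V : Type*}

theorem symmDiff_adj (X Y : SimpleGraph V) (p q : V) :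
    (X ∆ Y).Adj p q ↔ ¬ (X.Adj p q ↔ Y.Adj p q) := by
  simp only [symmDiff, SimpleGraph.sup_adj, SimpleGraph.sdiff_adj]; tauto

theorem edgeSet_symmDiff (X Y : SimpleGraph V) : (X ∆ Y).edgeSet = X.edgeSet ∆ Y.edgeSet := by
  simp [symmDiff]

/-- The graph `X` with the status of the three pairs of the triangle `a b c` inverted. As a
symmetric difference it is defined for all `a`, `b`, `c`, so that identities between flips need no
distinctness. -/
def flipTri (X : SimpleGraph V) (a b c : V) : SimpleGraph V :=
  X ∆ SimpleGraph.edge a b ∆ SimpleGraph.edge b c ∆ SimpleGraph.edge c a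

/-- The graph `X` with the status of the four pairs of the closed walk `a b c d` inverted. -/
def flipQuad (X : SimpleGraph V) (a b c d : V) : SimpleGraph V :=
  X ∆ SimpleGraph.edge a b ∆ SimpleGraph.edge b c ∆ SimpleGraph.edge c d ∆ SimpleGraph.edge d a

theorem flipTri_adj (X : SimpleGraph V) {a b c : V} (hab : a ≠ b) (hbc : b ≠ c) (hca : c ≠ a)
    (p q : V) : (flipTri X a b c).Adj p q ↔
     ¬ (X.Adj p q ↔ ((p = a ∧ q = b ∨ p = b ∧ q = a) ∨ (p = b ∧ q = c ∨ p = c ∧ q = b) ∨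
        (p = c ∧ q = a ∨ p = a ∧ q = c))) := by
  simp only [flipTri, symmDiff_adj, SimpleGraph.edge_adj]
  grind

theorem flipQuad_adj (X : SimpleGraph V) {a b c d : V} (h : [a, b, c, d].Nodup)
    (p q : V) : (flipQuad X a b c d).Adj p q ↔
     ¬ (X.Adj p q ↔ ((p = a ∧ q = b ∨ p = b ∧ q = a) ∨ (p = b ∧ q = c ∨ p = c ∧ q = b) ∨
        (p = c ∧ q = d ∨ p = d ∧ q = c) ∨ (p = d ∧ q = a ∨ p = a ∧ q = d))) := by
  simp only [flipQuad, symmDiff_adj, SimpleGraph.edge_adj]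
  simp at h
  grind

theorem flipQuad_flipQuad (X : SimpleGraph V) (a b c d : V) :
    flipQuad (flipQuad X a b c d) a b c d = X := by
  simp [flipQuad, symmDiff_comm, symmDiff_left_comm, symmDiff_assoc, SimpleGraph.edge_comm]

theorem flipTri_flipTri (X : SimpleGraph V) (a b c : V) :
    flipTri (flipTri X a b c) a b c = X := by
  simp [flipTri, symmDiff_comm, symmDiff_left_comm, symmDiff_assoc, SimpleGraph.edge_comm]

theorem flipTri_rotate (X : SimpleGraph V) (a b c : V) : flipTri X b c a = flipTri X a b c := by
  simp [flipTri, symmDiff_comm, symmDiff_left_comm, symmDiff_assoc, SimpleGraph.edge_comm]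

theorem flipTri_swap (X : SimpleGraph V) (a b c : V) : flipTri X b a c = flipTri X a b c := by
  simp [flipTri, symmDiff_comm, symmDiff_left_comm, symmDiff_assoc, SimpleGraph.edge_comm]

theorem flipQuad_rotate (X : SimpleGraph V) (a b c d : V) :
    flipQuad X b c d a = flipQuad X a b c d := by
  simp [flipQuad, symmDiff_comm, symmDiff_left_comm, symmDiff_assoc, SimpleGraph.edge_comm]

theorem flipQuad_reverse (X : SimpleGraph V) (a b c d : V) :
    flipQuad X c b a d = flipQuad X a b c d := by
  simp [flipQuad, symmDiff_comm, symmDiff_left_comm, symmDiff_assoc, SimpleGraph.edge_comm]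

theorem flipTri_flipQuad_comm (X : SimpleGraph V) (a b c d p q r : V) :
    flipTri (flipQuad X a b c d) p q r = flipQuad (flipTri X p q r) a b c d := by
  simp [flipTri, flipQuad, symmDiff_comm, symmDiff_left_comm, symmDiff_assoc,
    SimpleGraph.edge_comm]

theorem reachable_of_adj_imp {X Y : SimpleGraph V} (h : ∀ v w, X.Adj v w → Y.Reachable v w)
    {v w : V} (hvw : X.Reachable v w) : Y.Reachable v w := by
  rw [SimpleGraph.reachable_iff_reflTransGen] at hvw
  induction hvw with
  | refl => exact SimpleGraph.Reachable.refl _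
  | tail _ h1 ih => exact ih.trans (h _ _ h1)

end Flips

/-! ### Degree parities -/

section Parity
variable {V : Type*} [Fintype V]

open Classical in
/-- The degree of `v` in `X` modulo two. As a function of `X` it is additive under symmetric
differences. -/
noncomputable def degParity (X : SimpleGraph V) (v : V) : ZMod 2 :=
  ∑ w, if X.Adj v w then 1 else 0

open Classical in
theorem degParity_eq (X : SimpleGraph V) (v : V) : degParity X v = (X.degree v : ZMod 2) := by
  rw [degParity, ← SimpleGraph.card_neighborFinset_eq_degree, SimpleGraph.neighborFinset_eq_filter]
  simp

theorem degParity_symmDiff (X Y : SimpleGraph V) (v : V) :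
    degParity (X ∆ Y) v = degParity X v + degParity Y v := by
  rw [degParity, degParity, degParity, ← Finset.sum_add_distrib]
  refine Finset.sum_congr rfl fun w _ => ?_
  have e := symmDiff_adj X Y v w
  by_cases h1 : X.Adj v w <;> by_cases h2 : Y.Adj v w <;> simp only [h1, h2] at e <;>
    simp [h1, h2, e]
  decide

open Classical in
theorem degParity_edge (a b v : V) :
    degParity (SimpleGraph.edge a b) v = (if v = a then 1 else 0) + (if v = b then 1 else 0) := by
  rw [degParity]
  simp only [SimpleGraph.edge_adj]
  by_cases hab : a = b
  · subst hab
    have : ∀ w, ¬ (((v = a ∧ w = a) ∨ v = a ∧ w = a) ∧ v ≠ w) := by grind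
    simp only [this, if_false, Finset.sum_const_zero]
    split_ifs <;> decide
  · by_cases h1 : v = a
    · subst h1
      have : ∀ w, (((v = v ∧ w = b) ∨ v = b ∧ w = v) ∧ v ≠ w) ↔ w = b := by grind
      rw [Finset.sum_congr rfl fun w _ => if_congr (this w) rfl rfl]
      simp [hab]
    · by_cases h2 : v = b
      · subst h2
        have : ∀ w, (((v = a ∧ w = v) ∨ v = v ∧ w = a) ∧ v ≠ w) ↔ w = a := by grind
        rw [Finset.sum_congr rfl fun w _ => if_congr (this w) rfl rfl]
        simp [h1]
      · simp [h1, h2]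

open Classical in
theorem degParity_flipTri (X : SimpleGraph V) (a b c v : V) :
    degParity (flipTri X a b c) v = degParity X v := by
  simp only [flipTri, degParity_symmDiff, degParity_edge]
  have h2 : (2 : ZMod 2) = 0 := by decide
  linear_combination ((if v = a then 1 else 0) + (if v = b then 1 else 0)
    + (if v = c then 1 else 0)) * h2

open Classical in
theorem degParity_flipQuad (X : SimpleGraph V) (a b c d v : V) :
    degParity (flipQuad X a b c d) v = degParity X v := by
  simp only [flipQuad, degParity_symmDiff, degParity_edge]
  have h2 : (2 : ZMod 2) = 0 := by decide
  linear_combination ((if v = a then 1 else 0) + (if v = b then 1 else 0)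
    + (if v = c then 1 else 0) + (if v = d then 1 else 0)) * h2

end Parity

/-! ### Numbers of edges under flips -/

section Count
variable {V : Type*} [Fintype V]

theorem numEdges_eq_ncard (X : SimpleGraph V) : numEdges X = X.edgeSet.ncard := by
  classical
  rw [numEdges, ← SimpleGraph.coe_edgeFinset, Set.ncard_coe_finset]

theorem numEdges_symmDiff_edge_of_not_adj {X : SimpleGraph V} {a b : V} (hab : a ≠ b)
    (h : ¬ X.Adj a b) : numEdges (X ∆ SimpleGraph.edge a b) = numEdges X + 1 := by
  have : (X ∆ SimpleGraph.edge a b).edgeSet = insert s(a, b) X.edgeSet := by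
    rw [edgeSet_symmDiff, SimpleGraph.edgeSet_edge_of_ne hab]
    ext e
    have : e = s(a, b) → e ∉ X.edgeSet := by rintro rfl; exact h
    simp only [Set.mem_symmDiff, Set.mem_singleton_iff, Set.mem_insert_iff]; tauto
  rw [numEdges_eq_ncard, numEdges_eq_ncard, this, Set.ncard_insert_of_notMem (by exact h)
    (Set.toFinite _)]

theorem numEdges_symmDiff_edge_of_adj {X : SimpleGraph V} {a b : V}
    (h : X.Adj a b) : numEdges (X ∆ SimpleGraph.edge a b) + 1 = numEdges X := by
  have h1 : ¬ (X ∆ SimpleGraph.edge a b).Adj a b := by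
    simp [symmDiff_adj, h, SimpleGraph.edge_adj, h.ne]
  have := numEdges_symmDiff_edge_of_not_adj h.ne h1
  rwa [symmDiff_symmDiff_cancel_right, eq_comm] at this

/-- Replacing the edge `a b` by the path `a u b` adds one edge. -/
theorem numEdges_flipTri {X : SimpleGraph V} {a b u : V} (hab : X.Adj a b) (hau : ¬ X.Adj a u)
    (hbu : ¬ X.Adj b u) (h1 : a ≠ u) (h2 : b ≠ u) :
    numEdges (flipTri X a b u) = numEdges X + 1 := by
  have hne := hab.ne
  have e1 := numEdges_symmDiff_edge_of_adj hab
  have e2 := numEdges_symmDiff_edge_of_not_adj (X := X ∆ SimpleGraph.edge a b) h2 (by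
    simp only [symmDiff_adj, SimpleGraph.edge_adj]; grind)
  have e3 := numEdges_symmDiff_edge_of_not_adj
    (X := X ∆ SimpleGraph.edge a b ∆ SimpleGraph.edge b u) h1.symm (by
    simp only [symmDiff_adj, SimpleGraph.edge_adj]; grind [SimpleGraph.adj_comm])
  rw [flipTri]; omega

open Classical in
theorem cast_numEdges_flipQuad (X : SimpleGraph V) {a b c d : V} (h : [a, b, c, d].Nodup) :
    (numEdges (flipQuad X a b c d) : ℤ) = numEdges X + (if X.Adj a b then -1 else 1) +
      (if X.Adj b c then -1 else 1) + (if X.Adj c d then -1 else 1) +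
      (if X.Adj d a then -1 else 1) := by
  have key : ∀ (Y : SimpleGraph V) {p q : V}, p ≠ q → (Y.Adj p q ↔ X.Adj p q) →
      (numEdges (Y ∆ SimpleGraph.edge p q) : ℤ) = numEdges Y + if X.Adj p q then -1 else 1 := by
    intro Y p q hpq hY
    by_cases hX : X.Adj p q
    · have := numEdges_symmDiff_edge_of_adj (hY.2 hX)
      rw [if_pos hX]; omega
    · have := numEdges_symmDiff_edge_of_not_adj hpq (fun h => hX (hY.1 h))
      rw [if_neg hX]; omega
  simp only [List.nodup_cons, List.mem_cons, List.not_mem_nil, or_false, not_or] at h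
  rw [flipQuad, key _ (Ne.symm h.1.2.2), key _ h.2.2.1, key _ h.2.1.1, key _ h.1.1 Iff.rfl]
  all_goals simp only [symmDiff_adj, SimpleGraph.edge_adj]; grind

/-- A switch of two opposite sides of a quadrilateral preserves the number of edges. -/
theorem numEdges_flipQuad_of_opposite {X : SimpleGraph V} {a b c d : V} (h : [a, b, c, d].Nodup)
    (hab : X.Adj a b) (hbc : ¬ X.Adj b c) (hcd : X.Adj c d) (hda : ¬ X.Adj d a) :
    numEdges (flipQuad X a b c d) = numEdges X := by
  classical
  have := cast_numEdges_flipQuad X h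
  simp only [hab, hbc, hcd, hda, if_true, if_false] at this
  omega

/-- Replacing a path `a b c` by a path `a d c` preserves the number of edges. -/
theorem numEdges_flipQuad_of_adjacent {X : SimpleGraph V} {a b c d : V} (h : [a, b, c, d].Nodup)
    (hab : X.Adj a b) (hbc : X.Adj b c) (hcd : ¬ X.Adj c d) (hda : ¬ X.Adj d a) :
    numEdges (flipQuad X a b c d) = numEdges X := by
  classical
  have := cast_numEdges_flipQuad X h
  simp only [hab, hbc, hcd, hda, if_true, if_false] at this
  omega

end Count

/-! ### Eulerian graphs and sequences of 2-switches -/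

section Classes
variable {V : Type*} [Fintype V]

/-- `G` is, on the vertices of `U`, a connected graph all of whose degrees are even, and the
vertices outside `U` are isolated. Restricting to `U` instead of changing the vertex type makes it
possible to suppress vertices; `U` may be empty. -/
structure EulerianOn (U : Finset V) (G : SimpleGraph V) : Prop where
  parity : ∀ v, degParity G v = 0
  mem : ∀ v w, G.Adj v w → v ∈ U
  reach : ∀ v ∈ U, ∀ w ∈ U, G.Reachable v w

/-- A single 2-switch between Eulerian graphs on `U`: the status of the four pairs of a
quadrilateral is inverted, and the number of edges does not change. -/
def Move (U : Finset V) (G H : SimpleGraph V) : Prop :=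
  EulerianOn U G ∧ EulerianOn U H ∧ numEdges G = numEdges H ∧
    ∃ a b c d : V, [a, b, c, d].Nodup ∧ H = flipQuad G a b c d

/-- `G` and `H` are joined by a sequence of 2-switches between Eulerian graphs on `U`. -/
def Linked (U : Finset V) (G H : SimpleGraph V) : Prop := Relation.ReflTransGen (Move U) G H

variable {U : Finset V} {G H K : SimpleGraph V}

theorem Move.symm (h : Move U G H) : Move U H G := by
  obtain ⟨h1, h2, h3, a, b, c, d, h4, rfl⟩ := h
  exact ⟨h2, h1, h3.symm, a, b, c, d, h4, (flipQuad_flipQuad _ _ _ _ _).symm⟩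

theorem Linked.symm (h : Linked U G H) : Linked U H G := by
  induction h with
  | refl => exact Relation.ReflTransGen.refl
  | tail _ h1 ih => exact Relation.ReflTransGen.head h1.symm ih

theorem Linked.trans (h : Linked U G H) (h' : Linked U H K) : Linked U G K :=
  Relation.ReflTransGen.trans h h'

theorem Linked.refl (G : SimpleGraph V) : Linked U G G := Relation.ReflTransGen.refl

theorem linked_of_eq_flipQuad (hG : EulerianOn U G) (hH : EulerianOn U H)
    (hm : numEdges G = numEdges H) {a b c d : V} (h : [a, b, c, d].Nodup)
    (e : H = flipQuad G a b c d) : Linked U G H :=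
  Relation.ReflTransGen.single ⟨hG, hH, hm, a, b, c, d, h, e⟩

open Classical in
/-- Subdividing the edge `a b` by a vertex `u` not adjacent to `a` or `b` keeps the graph
Eulerian. -/
theorem EulerianOn.subdivide {X : SimpleGraph V} (hX : EulerianOn U X) {a b u : V} (hab : X.Adj a b)
    (hau : ¬ X.Adj a u) (hbu : ¬ X.Adj b u) (h1 : a ≠ u) (h2 : b ≠ u) :
    EulerianOn (insert u U) (flipTri X a b u) := by
  have hne := hab.ne
  have hadj := flipTri_adj X hab.ne h2 h1.symm
  have haU := hX.mem _ _ hab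
  have hbU := hX.mem _ _ hab.symm
  have hua : (flipTri X a b u).Adj u a := by rw [hadj]; grind [SimpleGraph.adj_comm]
  have hub : (flipTri X a b u).Adj u b := by rw [hadj]; grind [SimpleGraph.adj_comm]
  have key : ∀ v w, X.Reachable v w → (flipTri X a b u).Reachable v w := by
    intro v w h
    refine reachable_of_adj_imp (fun v w hvw => ?_) h
    by_cases e : v = a ∧ w = b ∨ v = b ∧ w = a
    · rcases e with ⟨rfl, rfl⟩ | ⟨rfl, rfl⟩
      · exact hua.symm.reachable.trans hub.reachable
      · exact hub.symm.reachable.trans hua.reachable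
    · refine SimpleGraph.Adj.reachable ?_
      rw [hadj]; grind [SimpleGraph.adj_comm]
  have key2 : ∀ v ∈ insert u U, (flipTri X a b u).Reachable a v := by
    intro v hv
    rcases Finset.mem_insert.1 hv with rfl | hv
    · exact hua.symm.reachable
    · exact key _ _ (hX.reach _ haU _ hv)
  refine ⟨fun v => by rw [degParity_flipTri, hX.parity], fun v w hvw => ?_, fun v hv w hw =>
    (key2 v hv).symm.trans (key2 w hw)⟩
  rw [hadj] at hvw
  by_cases e : X.Adj v w
  · exact Finset.mem_insert_of_mem (hX.mem _ _ e)
  · simp only [e, false_iff, not_not] at hvw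
    grind

end Classes

/-! ### Flips of quadrilaterals as 2-switches -/

section Switch
variable {V : Type*} [Fintype V]

/-- A flip that preserves the number of edges removes two of the four pairs and adds the other
two. -/
theorem isSwitch_of_flipQuad {G H : SimpleGraph V} {a b c d : V} (h : [a, b, c, d].Nodup)
    (e : H = flipQuad G a b c d) (hm : numEdges G = numEdges H) : IsSwitch 2 G H := by
  classical
  set Q : Finset (Sym2 V) := {s(a, b), s(b, c), s(c, d), s(d, a)} with hQ
  have hQc : Q.card = 4 := by
    simp at h
    rw [hQ]
    repeat rw [Finset.card_insert_of_notMem]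
    · simp
    all_goals simp; try grind
  have hE : H.edgeFinset = G.edgeFinset ∆ Q := by
    ext x
    induction x with | _ p q
    rw [SimpleGraph.mem_edgeFinset, Finset.mem_symmDiff, SimpleGraph.mem_edgeFinset,
      SimpleGraph.mem_edgeSet, SimpleGraph.mem_edgeSet, e, flipQuad_adj G h]
    simp only [hQ, Finset.mem_insert, Finset.mem_singleton, ← Sym2.eq_iff]
    tauto
  have hm' : G.edgeFinset.card = H.edgeFinset.card := by
    simp only [numEdges] at hm; convert hm
  have c1 : (G.edgeFinset ∩ Q).card + (Q \ G.edgeFinset).card = 4 := by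
    rw [← hQc, Finset.inter_comm, Finset.card_inter_add_card_sdiff]
  have c2 : (G.edgeFinset \ Q).card + (G.edgeFinset ∩ Q).card = G.edgeFinset.card :=
    Finset.card_sdiff_add_card_inter _ _
  have c3 : H.edgeFinset.card = (G.edgeFinset \ Q).card + (Q \ G.edgeFinset).card := by
    rw [hE, symmDiff, Finset.sup_eq_union, Finset.card_union_of_disjoint]
    exact disjoint_sdiff_sdiff
  refine ⟨G.edgeFinset ∩ Q, Q \ G.edgeFinset, by omega, by omega, ?_, ?_, ?_⟩
  · intro x; simp; tauto
  · rw [Set.disjoint_left]; intro x; simp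
  · rw [← SimpleGraph.coe_edgeFinset H, hE]
    ext x; simp [Set.mem_symmDiff]

end Switch

/-! ### Subdividing an edge -/

section Subdivision
variable {V : Type*}

/-- `a b` is an edge of `X` that can be subdivided by `u`, i.e. replaced by the path `a u b`.
Equivalently, `a u b` is an induced path of the complement of `X`. -/
structure Subdividable (X : SimpleGraph V) (a b u : V) : Prop where
  adj : X.Adj a b
  left : ¬ X.Adj a u
  right : ¬ X.Adj b u
  left_ne : a ≠ u
  right_ne : b ≠ u

theorem Subdividable.symm {X : SimpleGraph V} {a b u : V} (h : Subdividable X a b u) :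
    Subdividable X b a u := ⟨h.1.symm, h.3, h.2, h.5, h.4⟩

variable [Fintype V]

theorem EulerianOn.of_insert {U : Finset V} {u : V} {X : SimpleGraph V} [DecidableEq V]
    (h : EulerianOn (insert u U) X) (hu : u ∈ U) : EulerianOn U X := by
  rwa [Finset.insert_eq_of_mem hu] at h

theorem Subdividable.eulerianOn {X : SimpleGraph V} {a b u : V} (h : Subdividable X a b u)
    {U : Finset V} [DecidableEq V] (hX : EulerianOn U X) :
    EulerianOn (insert u U) (flipTri X a b u) := by
  convert hX.subdivide h.1 h.2 h.3 h.4 h.5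

theorem Subdividable.numEdges_eq {X : SimpleGraph V} {a b u : V} (h : Subdividable X a b u) :
    numEdges (flipTri X a b u) = numEdges X + 1 :=
  numEdges_flipTri h.1 h.2 h.3 h.4 h.5

theorem Subdividable.eulerianOn_univ {X : SimpleGraph V} {a b u : V} (h : Subdividable X a b u)
    (hX : EulerianOn Finset.univ X) : EulerianOn Finset.univ (flipTri X a b u) := by
  classical
  exact (h.eulerianOn hX).of_insert (Finset.mem_univ _)

end Subdivision

/-! ### Degrees of Eulerian graphs -/

section Degrees
variable {V : Type*} [Fintype V]

open Classical in
theorem EulerianOn.even_degree {U : Finset V} {G : SimpleGraph V} (h : EulerianOn U G) (v : V) :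
    Even (G.degree v) := by
  rw [← ZMod.natCast_eq_zero_iff_even, ← degParity_eq, h.parity]

open Classical in
theorem EulerianOn.two_le_degree {U : Finset V} {G : SimpleGraph V} (h : EulerianOn U G)
    (hU : 2 ≤ U.card) {v : V} (hv : v ∈ U) : 2 ≤ G.degree v := by
  obtain ⟨w, hw, hne⟩ := Finset.exists_mem_ne (by omega : 1 < U.card) v
  have hr := h.reach v hv w hw
  rw [SimpleGraph.reachable_iff_reflTransGen] at hr
  have : 0 < G.degree v := by
    rcases hr.cases_head with e | ⟨x, hx, _⟩
    · exact absurd e.symm hne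
    · exact (G.degree_pos_iff_exists_adj v).2 ⟨x, hx⟩
  have := h.even_degree v
  obtain ⟨r, hr⟩ := this
  omega

open Classical in
theorem sum_degree_eq (G : SimpleGraph V) : ∑ v, G.degree v = 2 * numEdges G := by
  rw [G.sum_degrees_eq_twice_card_edges, numEdges]

open Classical in
/-- A connected graph with all degrees even and no more edges than vertices is a cycle. -/
theorem EulerianOn.degree_eq_two {U : Finset V} {G : SimpleGraph V} (h : EulerianOn U G)
    (hU : 2 ≤ U.card) (hm : numEdges G ≤ U.card) {v : V} (hv : v ∈ U) : G.degree v = 2 := by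
  by_contra hne
  have h1 : ∑ v ∈ U, 2 < ∑ v ∈ U, G.degree v :=
    Finset.sum_lt_sum (fun i hi => h.two_le_degree hU hi)
      ⟨v, hv, lt_of_le_of_ne (h.two_le_degree hU hv) (Ne.symm hne)⟩
  have h2 : ∑ v ∈ U, G.degree v ≤ ∑ v, G.degree v :=
    Finset.sum_le_sum_of_subset (Finset.subset_univ _)
  rw [sum_degree_eq] at h2
  simp at h1
  omega

open Classical in
theorem EulerianOn.card_le_numEdges {U : Finset V} {G : SimpleGraph V} (h : EulerianOn U G)
    (hU : 2 ≤ U.card) : U.card ≤ numEdges G := by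
  have h1 : ∑ v ∈ U, 2 ≤ ∑ v ∈ U, G.degree v :=
    Finset.sum_le_sum (fun i hi => h.two_le_degree hU hi)
  have h2 : ∑ v ∈ U, G.degree v ≤ ∑ v, G.degree v :=
    Finset.sum_le_sum_of_subset (Finset.subset_univ _)
  rw [sum_degree_eq] at h2
  simp at h1
  omega

theorem EulerianOn.exists_adj_iff {U : Finset V} {G : SimpleGraph V} (h : EulerianOn U G)
    (hU : 2 ≤ U.card) (hm : numEdges G ≤ U.card) {v : V} (hv : v ∈ U) :
    ∃ a b, a ≠ b ∧ ∀ w, G.Adj v w ↔ w = a ∨ w = b := by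
  classical
  have := h.degree_eq_two hU hm hv
  rw [← SimpleGraph.card_neighborFinset_eq_degree, Finset.card_eq_two] at this
  obtain ⟨a, b, hab, e⟩ := this
  refine ⟨a, b, hab, fun w => ?_⟩
  rw [← SimpleGraph.mem_neighborFinset, e]; simp

end Degrees

/-! ### Cycles are linked -/

section Cycles
variable {V : Type*} [Fintype V]

theorem EulerianOn.adj_iff_of_card_le_three {U : Finset V} {G : SimpleGraph V}
    (h : EulerianOn U G) (hU : U.card ≤ 3) (hm : numEdges G ≤ U.card) (p q : V) :
    G.Adj p q ↔ p ∈ U ∧ q ∈ U ∧ p ≠ q := by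
  classical
  refine ⟨fun hpq => ⟨h.mem _ _ hpq, h.mem _ _ hpq.symm, hpq.ne⟩, fun ⟨hp, hq, hne⟩ => ?_⟩
  have h2 : 2 ≤ U.card := by
    have := Finset.card_le_card (show {p, q} ⊆ U by grind)
    rwa [Finset.card_pair hne] at this
  obtain ⟨a, b, hab, e⟩ := h.exists_adj_iff h2 hm hp
  by_contra hn
  have ha := (e a).2 (Or.inl rfl)
  have hb := (e b).2 (Or.inr rfl)
  have : ({p, q, a, b} : Finset V).card = 4 := by
    have h1 := ha.ne
    have h2 := hb.ne
    have h3 : q ≠ a := by grind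
    have h4 : q ≠ b := by grind
    rw [Finset.card_insert_of_notMem, Finset.card_insert_of_notMem, Finset.card_pair hab] <;> grind
  have h4 := Finset.card_le_card (show {p, q, a, b} ⊆ U by
    have := h.mem _ _ ha.symm
    have := h.mem _ _ hb.symm
    grind)
  omega

/-- Suppressing a vertex of a cycle with at least four vertices gives a shorter cycle. -/
theorem EulerianOn.exists_suppress {U : Finset V} {G : SimpleGraph V} [DecidableEq V]
    (h : EulerianOn U G) (hU : 4 ≤ U.card) (hm : numEdges G ≤ U.card) {u : V} (hu : u ∈ U) :
    ∃ X a b, EulerianOn (U.erase u) X ∧ X.Adj a b ∧ G = flipTri X a b u ∧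
      numEdges G = numEdges X + 1 := by
  obtain ⟨a, b, hab, e⟩ := h.exists_adj_iff (by omega) hm hu
  have ha := (e a).2 (Or.inl rfl)
  have hb := (e b).2 (Or.inr rfl)
  have hua := ha.ne
  have hub := hb.ne
  have hnab : ¬ G.Adj a b := by
    intro hadj
    obtain ⟨a1, a2, h1, ea⟩ := h.exists_adj_iff (by omega) hm (h.mem _ _ ha.symm)
    obtain ⟨b1, b2, h2, eb⟩ := h.exists_adj_iff (by omega) hm (h.mem _ _ hb.symm)
    have key : ∀ v, G.Reachable u v → v = u ∨ v = a ∨ v = b := by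
      intro v hv
      rw [SimpleGraph.reachable_iff_reflTransGen] at hv
      induction hv with
      | refl => simp
      | tail _ h3 ih => grind [SimpleGraph.adj_comm]
    have : U.card ≤ ({u, a, b} : Finset V).card :=
      Finset.card_le_card fun v hv => by have := key v (h.reach u hu v hv); grind
    have := Finset.card_le_three (a := u) (b := a) (c := b)
    omega
  have hadj := flipTri_adj G hab hub.symm hua
  have hX : (flipTri G a b u).Adj a b := by rw [hadj]; grind
  have hnu : ∀ v, ¬ (flipTri G a b u).Adj v u := by
    intro v; rw [hadj]; grind [SimpleGraph.adj_comm]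
  have hback : G = flipTri (flipTri G a b u) a b u := (flipTri_flipTri _ _ _ _).symm
  refine ⟨flipTri G a b u, a, b, ⟨fun v => by rw [degParity_flipTri, h.parity], ?_, ?_⟩, hX,
    hback, ?_⟩
  · intro v w hvw
    have : v ≠ u := by rintro rfl; exact hnu w hvw.symm
    refine Finset.mem_erase.2 ⟨this, ?_⟩
    by_cases e : G.Adj v w
    · exact h.mem _ _ e
    · rw [hadj] at hvw
      simp only [e, false_iff, not_not] at hvw
      have := h.mem _ _ ha.symm
      have := h.mem _ _ hb.symm
      grind
  · have key : ∀ v, G.Reachable a v → v = u ∨ (flipTri G a b u).Reachable a v := by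
      intro v hv
      rw [SimpleGraph.reachable_iff_reflTransGen] at hv
      induction hv with
      | refl => exact Or.inr (SimpleGraph.Reachable.refl _)
      | @tail x y _ h3 ih =>
        by_cases hy : y = u
        · exact Or.inl hy
        · right
          by_cases hx : x = u
          · subst hx
            rcases (e y).1 h3 with rfl | rfl
            · exact SimpleGraph.Reachable.refl _
            · exact hX.reachable
          · refine (ih.resolve_left hx).trans (SimpleGraph.Adj.reachable ?_)
            rw [hadj]; grind [SimpleGraph.adj_comm]
    have key2 : ∀ v ∈ U.erase u, (flipTri G a b u).Reachable a v := fun v hv =>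
      (key v (h.reach _ (h.mem _ _ ha.symm) _ (Finset.mem_of_mem_erase hv))).resolve_left
        (Finset.ne_of_mem_erase hv)
    exact fun v hv w hw => (key2 v hv).symm.trans (key2 w hw)
  · conv_lhs => rw [hback]
    exact numEdges_flipTri hX (hnu a) (hnu b) hua.symm hub.symm

/-- All subdivisions of a connected graph by a new vertex are linked, since this holds for two
edges with a common end. -/
theorem EulerianOn.linked_subdivisions {U : Finset V} {X : SimpleGraph V} [DecidableEq V]
    (hX : EulerianOn U X) {u : V} (hu : u ∉ U) {a b c d : V} (hab : X.Adj a b) (hcd : X.Adj c d) :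
    Linked (insert u U) (flipTri X a b u) (flipTri X c d u) := by
  have hs : ∀ {p q}, X.Adj p q → Subdividable X p q u := by
    intro p q h
    have hp := hX.mem _ _ h
    have hq := hX.mem _ _ h.symm
    exact ⟨h, fun h' => hu (hX.mem _ _ h'.symm), fun h' => hu (hX.mem _ _ h'.symm),
      by grind, by grind⟩
  have share : ∀ {p q r}, X.Adj p q → X.Adj p r →
      Linked (insert u U) (flipTri X p q u) (flipTri X p r u) := by
    intro p q r h1 h2
    by_cases e : q = r
    · subst e; exact Linked.refl _
    · have n1 := (hs h1).left_ne
      have n2 := (hs h1).right_ne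
      have n3 := (hs h2).right_ne
      have n4 := h1.ne
      have n5 := h2.ne
      refine linked_of_eq_flipQuad ((hs h1).eulerianOn hX) ((hs h2).eulerianOn hX)
        (by rw [(hs h1).numEdges_eq, (hs h2).numEdges_eq]) (a := p) (b := q) (c := u) (d := r)
        (by simp; grind) ?_
      simp [flipTri, flipQuad, symmDiff_comm, symmDiff_left_comm, symmDiff_assoc,
        SimpleGraph.edge_comm]
  have key : ∀ v, X.Reachable a v → ∀ w, X.Adj v w →
      Linked (insert u U) (flipTri X a b u) (flipTri X v w u) := by
    intro v hv
    rw [SimpleGraph.reachable_iff_reflTransGen] at hv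
    induction hv with
    | refl => exact fun w hw => share hab hw
    | @tail x y _ h3 ih =>
      intro w hw
      have h4 := ih y h3
      rw [← flipTri_swap X x y u] at h4
      exact h4.trans (share h3.symm hw)
  exact key c (hX.reach _ (hX.mem _ _ hab) _ (hX.mem _ _ hcd)) d hcd

/-- A 2-switch of a graph with at least three edges leaves some edge in place. -/
theorem Move.exists_common_adj {U : Finset V} {X Y : SimpleGraph V} (h : Move U X Y)
    (h3 : 3 ≤ numEdges X) : ∃ a b, X.Adj a b ∧ Y.Adj a b := by
  classical
  by_contra! hn
  -- Otherwise all edges of `X` and of `Y`, at least six, are among the four pairs.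
  obtain ⟨-, -, hm, a, b, c, d, hnd, rfl⟩ := h
  have h1 : X.edgeFinset ∪ (flipQuad X a b c d).edgeFinset ⊆
      {s(a, b), s(b, c), s(c, d), s(d, a)} := by
    intro e
    induction e with | _ p q
    intro he
    have h4 := hn p q
    have h5 := flipQuad_adj X hnd p q
    simp only [Finset.mem_union, SimpleGraph.mem_edgeFinset, SimpleGraph.mem_edgeSet] at he
    simp only [← Sym2.eq_iff] at h5
    simp only [Finset.mem_insert, Finset.mem_singleton]
    tauto
  have h2 : Disjoint X.edgeFinset (flipQuad X a b c d).edgeFinset := by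
    rw [Finset.disjoint_left]
    intro e
    induction e with | _ p q
    simpa using hn p q
  have h4 := Finset.card_le_card h1
  rw [Finset.card_union_of_disjoint h2] at h4
  have h5 := Finset.card_le_four (a := s(a, b)) (b := s(b, c)) (c := s(c, d)) (d := s(d, a))
  have e1 : X.edgeFinset.card = numEdges X := by rw [numEdges]
  have e2 : (flipQuad X a b c d).edgeFinset.card = numEdges (flipQuad X a b c d) := by
    rw [numEdges]
  omega

/-- A sequence of 2-switches lifts to subdivisions by a new vertex: at each 2-switch one subdivides
an edge that it leaves in place. -/
theorem Linked.subdivisions {U : Finset V} {X Y : SimpleGraph V} [DecidableEq V]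
    (h : Linked U X Y) (hX : EulerianOn U X) (h3 : 3 ≤ numEdges X) {u : V} (hu : u ∉ U)
    {a b c d : V} (hab : X.Adj a b) (hcd : Y.Adj c d) :
    Linked (insert u U) (flipTri X a b u) (flipTri Y c d u) := by
  have key : EulerianOn U Y ∧ 3 ≤ numEdges Y ∧ ∀ c d, Y.Adj c d →
      Linked (insert u U) (flipTri X a b u) (flipTri Y c d u) := by
    clear hcd
    induction h with
    | refl => exact ⟨hX, h3, fun c d hcd => hX.linked_subdivisions hu hab hcd⟩
    | @tail Y Z _ h1 ih =>
      obtain ⟨hY, h4, ih⟩ := ih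
      obtain ⟨p, q, hp, hq⟩ := h1.exists_common_adj h4
      obtain ⟨-, hZ, hm, x, y, z, w, hnd, rfl⟩ := h1
      refine ⟨hZ, by omega, fun c d hcd => ?_⟩
      refine (ih p q hp).trans (Linked.trans ?_ (hZ.linked_subdivisions hu hq hcd))
      have hpU := hY.mem _ _ hp
      have hqU := hY.mem _ _ hp.symm
      have s1 : Subdividable Y p q u := ⟨hp, fun h' => hu (hY.mem _ _ h'.symm),
        fun h' => hu (hY.mem _ _ h'.symm), by grind, by grind⟩
      have s2 : Subdividable (flipQuad Y x y z w) p q u := ⟨hq, fun h' => hu (hZ.mem _ _ h'.symm),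
        fun h' => hu (hZ.mem _ _ h'.symm), by grind, by grind⟩
      exact linked_of_eq_flipQuad (s1.eulerianOn hY) (s2.eulerianOn hZ)
        (by rw [s1.numEdges_eq, s2.numEdges_eq, hm]) hnd (flipTri_flipQuad_comm _ _ _ _ _ _ _ _)
  exact key.2.2 c d hcd

/-- Any two cycles on the same vertex set are linked. -/
theorem EulerianOn.linked_of_numEdges_le {U : Finset V} {G H : SimpleGraph V}
    (hG : EulerianOn U G) (hH : EulerianOn U H) (hmG : numEdges G ≤ U.card)
    (hmH : numEdges H ≤ U.card) : Linked U G H := by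
  classical
  induction hk : U.card generalizing U G H with
  | zero =>
    have : G = H := by
      ext p q
      rw [hG.adj_iff_of_card_le_three (by omega) hmG, hH.adj_iff_of_card_le_three (by omega) hmH]
    exact this ▸ Linked.refl _
  | succ k ih =>
    by_cases h3 : U.card ≤ 3
    · have : G = H := by
        ext p q
        rw [hG.adj_iff_of_card_le_three h3 hmG, hH.adj_iff_of_card_le_three h3 hmH]
      exact this ▸ Linked.refl _
    · obtain ⟨u, hu⟩ := Finset.card_pos.1 (by omega : 0 < U.card)
      obtain ⟨X, a, b, hX, hab, rfl, hmX⟩ := hG.exists_suppress (by omega) hmG hu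
      obtain ⟨Y, c, d, hY, hcd, rfl, hmY⟩ := hH.exists_suppress (by omega) hmH hu
      have hc := Finset.card_erase_of_mem hu
      have h4 := hX.card_le_numEdges (by omega)
      have h5 := ih hX hY (by omega) (by omega) (by omega)
      have := h5.subdivisions hX (by omega) (Finset.notMem_erase u U) hab hcd
      rwa [Finset.insert_erase hu] at this

end Cycles

/-! ### Connectedness, and a graph with one edge fewer -/

section Connectivity
variable {V : Type*} [Fintype V]

/-- A 2-switch preserves connectedness as soon as the four vertices involved remain connected to
each other. -/
theorem EulerianOn.flipQuad_of_reachable {X : SimpleGraph V} (hX : EulerianOn Finset.univ X)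
    {a b c d : V} (h : [a, b, c, d].Nodup) (hb : (flipQuad X a b c d).Reachable a b)
    (hc : (flipQuad X a b c d).Reachable a c) (hd : (flipQuad X a b c d).Reachable a d) :
    EulerianOn Finset.univ (flipQuad X a b c d) := by
  refine ⟨fun v => by rw [degParity_flipQuad, hX.parity], fun _ _ _ => Finset.mem_univ _,
    fun v hv w hw => reachable_of_adj_imp (fun p q hpq => ?_) (hX.reach v hv w hw)⟩
  by_cases e : (flipQuad X a b c d).Adj p q
  · exact e.reachable
  · have hbc := hb.symm.trans hc
    have hcd := hc.symm.trans hd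
    rw [flipQuad_adj X h] at e
    simp only [hpq, true_iff, not_not] at e
    rcases e with (⟨rfl, rfl⟩ | ⟨rfl, rfl⟩) | (⟨rfl, rfl⟩ | ⟨rfl, rfl⟩) |
      (⟨rfl, rfl⟩ | ⟨rfl, rfl⟩) | (⟨rfl, rfl⟩ | ⟨rfl, rfl⟩)
    exacts [hb, hb.symm, hbc, hbc.symm, hcd, hcd.symm, hd.symm, hd]

/-- Every component of `G - u` sends an even number of edges to `u`, hence at least two if it sends
any. -/
theorem EulerianOn.exists_second_neighbor {G : SimpleGraph V} (hG : EulerianOn Finset.univ G)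
    {u a : V} (ha : G.Adj u a) :
    ∃ d, d ≠ a ∧ G.Adj u d ∧ (G.deleteIncidenceSet u).Reachable a d := by
  classical
  by_contra! hn
  set D := G.deleteIncidenceSet u with hD
  have hDu : ¬ D.Reachable a u := by
    intro h
    rw [SimpleGraph.reachable_iff_reflTransGen] at h
    rcases h.cases_tail with e | ⟨x, _, hx⟩
    · exact ha.ne e
    · rw [hD, SimpleGraph.deleteIncidenceSet_adj] at hx
      exact hx.2.2 rfl
  -- The edges of `G` that meet the component of `a` in `G - u`.
  let Z : SimpleGraph V :=
    { Adj := fun v w => G.Adj v w ∧ (D.Reachable a v ∨ D.Reachable a w)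
      symm := ⟨fun v w h => ⟨h.1.symm, h.2.symm⟩⟩
      loopless := ⟨fun v h => h.1.ne rfl⟩ }
  have hZ : ∀ v w, Z.Adj v w ↔ G.Adj v w ∧ (D.Reachable a v ∨ D.Reachable a w) :=
    fun _ _ => Iff.rfl
  have h0 : ∀ v, v ≠ u → degParity Z v = 0 := by
    intro v hv
    by_cases hr : D.Reachable a v
    · rw [← hG.parity v, degParity, degParity]
      exact Finset.sum_congr rfl fun w _ => by simp [hZ, hr]
    · rw [degParity]
      refine Finset.sum_eq_zero fun w _ => ?_
      rw [if_neg]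
      rintro ⟨h1, h2⟩
      have h3 := h2.resolve_left hr
      have hw : w ≠ u := by rintro rfl; exact hDu h3
      exact hr (h3.trans (SimpleGraph.Adj.reachable
        ((SimpleGraph.deleteIncidenceSet_adj ..).2 ⟨h1.symm, hw, hv⟩)))
  have hu : degParity Z u = 1 := by
    rw [degParity, Finset.sum_eq_single a]
    · rw [if_pos]
      exact ⟨ha, Or.inr (SimpleGraph.Reachable.refl _)⟩
    · intro w _ hwa
      rw [if_neg]
      rintro ⟨h1, h2⟩
      exact hn w hwa h1 (h2.resolve_left hDu)
    · simp
  have hs : ∑ v, degParity Z v = 0 := by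
    simp only [degParity_eq]
    rw [← Nat.cast_sum, sum_degree_eq, Nat.cast_mul]
    have : ((2 : ℕ) : ZMod 2) = 0 := by decide
    rw [this, zero_mul]
  rw [Finset.sum_eq_single u (fun v _ hv => h0 v hv) (by simp), hu] at hs
  exact one_ne_zero hs

open Classical in
/-- In an Eulerian graph that is not complete, some vertex of degree at least four has two
nonadjacent neighbors, since otherwise the closed neighborhood of such a vertex is a clique and a
component. -/
theorem EulerianOn.exists_nonadjacent_neighbors {G : SimpleGraph V}
    (hG : EulerianOn Finset.univ G) (htop : G ≠ ⊤) {u : V} (hu : 4 ≤ G.degree u) :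
    ∃ v a b, 4 ≤ G.degree v ∧ G.Adj v a ∧ G.Adj v b ∧ a ≠ b ∧ ¬ G.Adj a b := by
  by_contra! hn
  have hdeg : ∀ a, G.Adj u a → 4 ≤ G.degree a := by
    intro a ha
    refine hu.trans ?_
    have hsub : insert u ((G.neighborFinset u).erase a) ⊆ G.neighborFinset a := by
      intro w hw
      simp only [Finset.mem_insert, Finset.mem_erase, SimpleGraph.mem_neighborFinset] at hw ⊢
      rcases hw with rfl | ⟨h1, h2⟩
      · exact ha.symm
      · exact hn u a w hu ha h2 (Ne.symm h1)
    have h1 := Finset.card_le_card hsub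
    have h2 := G.card_neighborFinset_eq_degree u
    have h3 := G.card_neighborFinset_eq_degree a
    rw [Finset.card_insert_of_notMem (by simp), Finset.card_erase_of_mem (by simpa using ha)] at h1
    omega
  have key : ∀ v, v = u ∨ G.Adj u v := by
    intro v
    have hr := hG.reach u (Finset.mem_univ _) v (Finset.mem_univ _)
    rw [SimpleGraph.reachable_iff_reflTransGen] at hr
    induction hr with
    | refl => exact Or.inl rfl
    | @tail x y _ h1 ih =>
      rcases ih with rfl | h2
      · exact Or.inr h1
      · by_cases e : y = u
        · exact Or.inl e
        · exact Or.inr (hn x u y (hdeg x h2) h2.symm h1 (Ne.symm e))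
  refine htop ?_
  ext p q
  refine ⟨fun h => by simpa using h.ne, fun h => ?_⟩
  have hpq : p ≠ q := by simpa using h
  rcases key p with rfl | hp
  · exact (key q).resolve_left (Ne.symm hpq)
  · rcases key q with rfl | hq
    · exact hp.symm
    · exact hn u p q hu hp hq hpq

open Classical in
/-- An Eulerian graph that is neither complete nor a cycle is a subdivision, in the sense of
`Subdividable`, of an Eulerian graph with one edge fewer on the same vertices. -/
theorem EulerianOn.exists_eq_flipTri {G : SimpleGraph V}
    (hG : EulerianOn Finset.univ G) (htop : G ≠ ⊤) {u : V} (hu : 4 ≤ G.degree u) :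
    ∃ X a b v, EulerianOn Finset.univ X ∧ Subdividable X a b v ∧ G = flipTri X a b v := by
  obtain ⟨v, a, b, hv, ha, hb, hab, hnab⟩ := hG.exists_nonadjacent_neighbors htop hu
  -- The pair `a b` can be chosen so that `v` stays connected to `a` once `v a`, `v b` are removed.
  obtain ⟨a, b, c, ha, hb, hc, hab, hca, hcb, hnab, hac⟩ : ∃ a b c, G.Adj v a ∧ G.Adj v b ∧
      G.Adj v c ∧ a ≠ b ∧ c ≠ a ∧ c ≠ b ∧ ¬ G.Adj a b ∧
      (G.deleteIncidenceSet v).Reachable a c := by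
    obtain ⟨d, hda, hd, hr⟩ := hG.exists_second_neighbor ha
    by_cases hdb : d = b
    · subst hdb
      obtain ⟨c, hc, hcab⟩ : ∃ c, G.Adj v c ∧ c ∉ ({a, d} : Finset V) := by
        by_contra! hn
        have := Finset.card_le_card (show G.neighborFinset v ⊆ {a, d} from fun w hw =>
          hn w ((G.mem_neighborFinset v w).1 hw))
        rw [G.card_neighborFinset_eq_degree, Finset.card_pair hab] at this
        omega
      simp only [Finset.mem_insert, Finset.mem_singleton, not_or] at hcab
      by_cases hac : G.Adj a c
      · exact ⟨a, d, c, ha, hd, hc, hab, hcab.1, hcab.2, hnab, SimpleGraph.Adj.reachable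
          ((SimpleGraph.deleteIncidenceSet_adj ..).2 ⟨hac, ha.ne.symm, hc.ne.symm⟩)⟩
      · exact ⟨a, c, d, ha, hc, hd, Ne.symm hcab.1, hda, Ne.symm hcab.2, hac, hr⟩
    · exact ⟨a, b, d, ha, hb, hd, hab, hda, hdb, hnab, hr⟩
  have hva := ha.ne
  have hvb := hb.ne
  have hvc := hc.ne
  have hadj := flipTri_adj G hab hvb.symm hva
  have hX : (flipTri G a b v).Adj a b := by rw [hadj]; grind
  have h1 : ¬ (flipTri G a b v).Adj a v := by rw [hadj]; grind [SimpleGraph.adj_comm]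
  have h2 : ¬ (flipTri G a b v).Adj b v := by rw [hadj]; grind [SimpleGraph.adj_comm]
  have hvc' : (flipTri G a b v).Adj v c := by rw [hadj]; grind [SimpleGraph.adj_comm]
  have hra : (flipTri G a b v).Reachable v a := by
    refine hvc'.reachable.trans (SimpleGraph.Reachable.symm ?_)
    refine reachable_of_adj_imp (fun p q hpq => SimpleGraph.Adj.reachable ?_) hac
    rw [SimpleGraph.deleteIncidenceSet_adj] at hpq
    obtain ⟨hpq, hp, hq⟩ := hpq
    rw [hadj]; grind [SimpleGraph.adj_comm]
  have hrb := hra.trans hX.reachable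
  refine ⟨flipTri G a b v, a, b, v, ⟨fun w => by rw [degParity_flipTri, hG.parity],
    fun _ _ _ => Finset.mem_univ _, fun x hx y hy =>
      reachable_of_adj_imp (fun p q hpq => ?_) (hG.reach x hx y hy)⟩,
    ⟨hX, h1, h2, hva.symm, hvb.symm⟩, (flipTri_flipTri _ _ _ _).symm⟩
  by_cases e : (flipTri G a b v).Adj p q
  · exact e.reachable
  · rw [hadj] at e
    simp only [hpq, true_iff, not_not] at e
    rcases e with (⟨rfl, rfl⟩ | ⟨rfl, rfl⟩) | (⟨rfl, rfl⟩ | ⟨rfl, rfl⟩) | (⟨rfl, rfl⟩ | ⟨rfl, rfl⟩)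
    exacts [hX.reachable, hX.symm.reachable, hrb.symm, hrb, hra, hra.symm]

end Connectivity

/-! ### All subdivisions of a graph are linked -/

section Subdivisions
variable {V : Type*} [Fintype V]

/-- Two subdivisions are linked if they differ by the flip of a quadrilateral. -/
theorem linked_flipTri {X X' : SimpleGraph V} (hX : EulerianOn Finset.univ X)
    (hX' : EulerianOn Finset.univ X') (hm : numEdges X = numEdges X') {p q r p' q' r' : V}
    (h : Subdividable X p q r) (h' : Subdividable X' p' q' r') (x y z w : V)
    (hn : [x, y, z, w].Nodup)
    (e : flipTri X' p' q' r' = flipQuad (flipTri X p q r) x y z w) :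
    Linked Finset.univ (flipTri X p q r) (flipTri X' p' q' r') :=
  linked_of_eq_flipQuad (h.eulerianOn_univ hX) (h'.eulerianOn_univ hX')
    (by rw [h.numEdges_eq, h'.numEdges_eq, hm]) hn e

variable {X : SimpleGraph V}

theorem EulerianOn.linked_of_common_end (hX : EulerianOn Finset.univ X) {a b b' u : V}
    (h : Subdividable X a b u) (h' : Subdividable X a b' u) :
    Linked Finset.univ (flipTri X a b u) (flipTri X a b' u) := by
  by_cases e : b = b'
  · subst e; exact Linked.refl _
  · refine linked_flipTri hX hX rfl h h' a b u b' ?_ ?_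
    · have := h.adj.ne; have := h'.adj.ne; have := h.left_ne; have := h.right_ne
      have := h'.right_ne
      simp; grind
    · simp [flipTri, flipQuad, symmDiff_comm, symmDiff_left_comm, symmDiff_assoc,
        SimpleGraph.edge_comm]

theorem EulerianOn.linked_of_common_edge (hX : EulerianOn Finset.univ X) {a b u v : V}
    (h : Subdividable X a b u) (h' : Subdividable X a b v) :
    Linked Finset.univ (flipTri X a b u) (flipTri X a b v) := by
  by_cases e : u = v
  · subst e; exact Linked.refl _
  · refine linked_flipTri hX hX rfl h h' a u b v ?_ ?_
    · have := h.adj.ne; have := h'.adj.ne; have := h.left_ne; have := h.right_ne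
      have := h'.right_ne; have := h'.left_ne
      simp; grind
    · simp [flipTri, flipQuad, symmDiff_comm, symmDiff_left_comm, symmDiff_assoc,
        SimpleGraph.edge_comm]

/-- In the complement, `a u b` and `u a w` are induced paths that share the edge `a u`. -/
theorem EulerianOn.linked_of_reverse (hX : EulerianOn Finset.univ X) {a b u w : V}
    (h : Subdividable X a b u) (h' : Subdividable X u w a) :
    Linked Finset.univ (flipTri X a b u) (flipTri X u w a) := by
  have e : b ≠ w := by rintro rfl; exact h'.right h.adj.symm
  refine linked_flipTri hX hX rfl h h' a b u w ?_ ?_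
  · have := h.adj.ne; have := h'.adj.ne; have := h.left_ne; have := h.right_ne
    have := h'.right_ne; have := h'.left_ne
    simp; grind
  · simp [flipTri, flipQuad, symmDiff_comm, symmDiff_left_comm, symmDiff_assoc,
      SimpleGraph.edge_comm]

theorem EulerianOn.linked_of_center_eq (hX : EulerianOn Finset.univ X) {a b a' b' u : V}
    (h : Subdividable X a b u) (h' : Subdividable X a' b' u) :
    Linked Finset.univ (flipTri X a b u) (flipTri X a' b' u) := by
  have sw : ∀ {p q}, Linked Finset.univ (flipTri X p q u) (flipTri X q p u) := by
    intro p q; rw [flipTri_swap]; exact Linked.refl _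
  have cross : ∀ {a b a' b'}, Subdividable X a b u → Subdividable X a' b' u → X.Adj a a' →
      Linked Finset.univ (flipTri X a b u) (flipTri X a' b' u) := by
    intro a b a' b' h h' e
    have h1 : Subdividable X a a' u := ⟨e, h.2, h'.2, h.4, h'.4⟩
    exact (hX.linked_of_common_end h h1).trans (sw.trans (hX.linked_of_common_end h1.symm h'))
  by_cases e1 : X.Adj a a'
  · exact cross h h' e1
  by_cases e2 : X.Adj b a'
  · exact sw.trans (cross h.symm h' e2)
  by_cases e3 : X.Adj a b'
  · exact (cross h h'.symm e3).trans sw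
  by_cases n1 : a = a'
  · subst n1; exact hX.linked_of_common_end h h'
  by_cases n2 : b = a'
  · subst n2; exact sw.trans (hX.linked_of_common_end h.symm h')
  by_cases n3 : a = b'
  · subst n3; exact (hX.linked_of_common_end h h'.symm).trans sw
  -- In the complement both ends of the first path are now adjacent to `a'`, and `a` to `b'`.
  have s1 : Subdividable X a b a' := ⟨h.1, e1, e2, n1, n2⟩
  have s2 : Subdividable X a' b' a := ⟨h'.1, fun h => e1 h.symm, fun h => e3 h.symm,
    Ne.symm n1, Ne.symm n3⟩
  exact (hX.linked_of_common_edge h s1).trans ((hX.linked_of_reverse s1 s2).trans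
    (hX.linked_of_common_edge s2 h'))

theorem EulerianOn.linked_of_center_not_adj (hX : EulerianOn Finset.univ X) {a b u x y v : V}
    (h : Subdividable X a b u) (h' : Subdividable X x y v) (huv : u ≠ v) (hadj : ¬ X.Adj u v) :
    Linked Finset.univ (flipTri X a b u) (flipTri X x y v) := by
  have hadj' : ¬ X.Adj v u := fun h => hadj h.symm
  have sub : ∀ {a b u v : V}, Subdividable X a b u → u ≠ v → ¬ X.Adj v u →
      (Subdividable X a b v) ∨ ∃ w, Subdividable X w v u := by
    intro a b u v h huv hadj
    by_cases h1 : X.Adj a v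
    · exact Or.inr ⟨a, h1, h.2, hadj, h.4, huv.symm⟩
    by_cases h2 : X.Adj b v
    · exact Or.inr ⟨b, h2, h.3, hadj, h.5, huv.symm⟩
    refine Or.inl ⟨h.1, h1, h2, ?_, ?_⟩
    · rintro rfl; exact h2 h.1.symm
    · rintro rfl; exact h1 h.1
  rcases sub h huv hadj' with h1 | ⟨w, hw⟩
  · exact (hX.linked_of_common_edge h h1).trans (hX.linked_of_center_eq h1 h')
  rcases sub h' huv.symm hadj with h1 | ⟨w', hw'⟩
  · exact (hX.linked_of_center_eq h h1).trans (hX.linked_of_common_edge h1 h')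
  refine (hX.linked_of_center_eq h hw.symm).trans (Linked.trans ?_ (hX.linked_of_center_eq hw' h'))
  have := hX.linked_of_reverse hw.symm hw'.symm
  rwa [flipTri_swap X w' u v] at this

/-- Subdivisions with centers in the same component of the complement are linked, by induction along
a path of the complement from `u` to `v`. -/
theorem EulerianOn.linked_of_compl_reachable (hX : EulerianOn Finset.univ X) {a b u x y v : V}
    (h : Subdividable X a b u) (h' : Subdividable X x y v) (hr : Xᶜ.Reachable u v) :
    Linked Finset.univ (flipTri X a b u) (flipTri X x y v) := by
  have step : ∀ {u v a b x y : V}, Subdividable X a b u → Subdividable X x y v →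
      (v = u ∨ Xᶜ.Adj u v) → Linked Finset.univ (flipTri X a b u) (flipTri X x y v) := by
    rintro u v a b x y h h' (rfl | e)
    · exact hX.linked_of_center_eq h h'
    · rw [SimpleGraph.compl_adj] at e
      exact hX.linked_of_center_not_adj h h' e.1 e.2
  -- The invariant has to cover neighbors as well, since a vertex on the path need not be the
  -- center of an induced path; if it is not, its neighbors are adjacent to each other.
  have key : ∀ v, Xᶜ.Reachable u v → ∀ w, (w = v ∨ Xᶜ.Adj v w) → ∀ x y, Subdividable X x y w →
      Linked Finset.univ (flipTri X a b u) (flipTri X x y w) := by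
    intro v hv
    rw [SimpleGraph.reachable_iff_reflTransGen] at hv
    induction hv with
    | refl => exact fun w hw x y h' => step h h' hw
    | @tail v v' _ h3 ih =>
      intro w hw x y h'
      by_cases e1 : w = v'
      · exact ih w (Or.inr (e1 ▸ h3)) x y h'
      by_cases e2 : w = v
      · exact ih w (Or.inl e2) x y h'
      by_cases e3 : Xᶜ.Adj v w
      · exact ih w (Or.inr e3) x y h'
      have hw := hw.resolve_left e1
      rw [SimpleGraph.compl_adj] at h3 hw e3
      have e4 : X.Adj v w := by
        by_contra hn; exact e3 ⟨Ne.symm e2, hn⟩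
      have s : Subdividable X v w v' := ⟨e4, h3.2, fun h => hw.2 h.symm, h3.1, e1⟩
      exact (ih v' (Or.inr ((SimpleGraph.compl_adj ..).2 h3)) v w s).trans
        (hX.linked_of_center_not_adj s h' hw.1 hw.2)
  exact key v hr v (Or.inl rfl) x y h'

/-- Subdivisions located in different components of the complement are linked by three
2-switches on the six vertices involved, between which `X` has all edges. -/
theorem EulerianOn.linked_of_join (hX : EulerianOn Finset.univ X) {a b u a' b' u' : V}
    (h : Subdividable X a b u) (h' : Subdividable X a' b' u')
    (hj : ∀ p ∈ [a, b, u], ∀ q ∈ [a', b', u'], X.Adj p q) :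
    Linked Finset.univ (flipTri X a b u) (flipTri X a' b' u') := by
  obtain ⟨h1, h2, h3, h4, h5⟩ := id h
  obtain ⟨h1', h2', h3', h4', h5'⟩ := id h'
  simp only [List.mem_cons, List.not_mem_nil, or_false, forall_eq_or_imp, forall_eq] at hj
  obtain ⟨⟨j1, j2, j3⟩, ⟨j4, j5, j6⟩, ⟨j7, j8, j9⟩⟩ := hj
  have n0 := h1.ne
  have n0' := h1'.ne
  have n1 := j1.ne
  have n2 := j2.ne
  have n3 := j3.ne
  have n4 := j4.ne
  have n5 := j5.ne
  have n6 := j6.ne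
  have n7 := j7.ne
  have n8 := j8.ne
  have n9 := j9.ne
  have hadj := flipTri_adj X n0 h5 h4.symm
  have d1 : [a', u', b', u].Nodup := by simp; grind
  have d2 : [a, b, a', u].Nodup := by simp; grind
  have d3 : [a', b, u, b'].Nodup := by simp; grind
  set Y := flipTri X a b u with hY
  have hadj1 := flipQuad_adj Y d1
  set Y1 := flipQuad Y a' u' b' u with hY1
  have hadj2 := flipQuad_adj Y1 d2
  set Y2 := flipQuad Y1 a b a' u with hY2
  have E0 : EulerianOn Finset.univ Y := h.eulerianOn_univ hX
  have E3 := h'.eulerianOn_univ hX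
  have e3 : flipTri X a' b' u' = flipQuad Y2 a' b u b' := by
    simp [Y2, Y1, Y, flipTri, flipQuad, symmDiff_comm, symmDiff_left_comm, symmDiff_assoc,
      SimpleGraph.edge_comm]
  have y1 : Y.Adj a u := by rw [hadj]; grind
  have y2 : Y.Adj b u := by rw [hadj]; grind
  have y3 : ¬ Y.Adj a b := by rw [hadj]; grind
  have y4 : Y.Adj a' b' := by rw [hadj]; grind
  have y5 : ¬ Y.Adj a' u' := by rw [hadj]; grind
  have y6 : ¬ Y.Adj b' u' := by rw [hadj]; grind
  have y7 : Y.Adj a a' := by rw [hadj]; grind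
  have y8 : Y.Adj b a' := by rw [hadj]; grind
  have y9 : Y.Adj u a' := by rw [hadj]; grind
  have y10 : Y.Adj u b' := by rw [hadj]; grind
  clear_value Y
  have z1 : Y1.Adj a' b' := by rw [hadj1]; grind [SimpleGraph.adj_comm]
  have z2 : Y1.Adj a' u' := by rw [hadj1]; grind [SimpleGraph.adj_comm]
  have z3 : Y1.Adj a' a := by rw [hadj1]; grind [SimpleGraph.adj_comm]
  have z4 : Y1.Adj a u := by rw [hadj1]; grind [SimpleGraph.adj_comm]
  have z5 : Y1.Adj b a' := by rw [hadj1]; grind [SimpleGraph.adj_comm]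
  have z6 : ¬ Y1.Adj a b := by rw [hadj1]; grind [SimpleGraph.adj_comm]
  have z7 : ¬ Y1.Adj a' u := by rw [hadj1]; grind [SimpleGraph.adj_comm]
  have m1 : numEdges Y1 = numEdges Y := by
    rw [hY1, ← flipQuad_rotate, ← flipQuad_rotate]
    exact numEdges_flipQuad_of_adjacent (by simp; grind) y10.symm y9 y5 (fun h => y6 h.symm)
  have E1 : EulerianOn Finset.univ Y1 := E0.flipQuad_of_reachable d1 z2.reachable z1.reachable
    (z3.reachable.trans z4.reachable)
  have w1 : Y2.Adj a b := by rw [hadj2]; grind [SimpleGraph.adj_comm]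
  have w2 : Y2.Adj a a' := by rw [hadj2]; grind [SimpleGraph.adj_comm]
  have w3 : Y2.Adj a' u := by rw [hadj2]; grind [SimpleGraph.adj_comm]
  have m2 : numEdges Y2 = numEdges Y1 := by
    rw [hY2, ← flipQuad_rotate]
    exact numEdges_flipQuad_of_opposite (by simp; grind) z5 z7 z4.symm z6
  have E2 : EulerianOn Finset.univ Y2 := E1.flipQuad_of_reachable d2 w1.reachable w2.reachable
    (w2.reachable.trans w3.reachable)
  have m3 : numEdges Y = numEdges (flipTri X a' b' u') := by
    rw [hY, h.numEdges_eq, h'.numEdges_eq]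
  exact (linked_of_eq_flipQuad E0 E1 m1.symm d1 hY1).trans
    ((linked_of_eq_flipQuad E1 E2 m2.symm d2 hY2).trans
      (linked_of_eq_flipQuad E2 E3 (by omega) d3 e3))

/-- All subdivisions of an Eulerian graph on the same vertex set are linked. -/
theorem EulerianOn.linked_flipTri (hX : EulerianOn Finset.univ X) {a b u a' b' u' : V}
    (h : Subdividable X a b u) (h' : Subdividable X a' b' u') :
    Linked Finset.univ (flipTri X a b u) (flipTri X a' b' u') := by
  -- The vertices of an induced path lie in the component of its center.
  by_cases hr : Xᶜ.Reachable u u'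
  · exact hX.linked_of_compl_reachable h h' hr
  · have near : ∀ {a b u : V}, Subdividable X a b u → ∀ p ∈ [a, b, u], Xᶜ.Reachable u p := by
      intro a b u h p hp
      simp only [List.mem_cons, List.not_mem_nil, or_false] at hp
      rcases hp with rfl | rfl | rfl
      · exact SimpleGraph.Adj.reachable
          ((SimpleGraph.compl_adj ..).2 ⟨h.4.symm, fun e => h.2 e.symm⟩)
      · exact SimpleGraph.Adj.reachable
          ((SimpleGraph.compl_adj ..).2 ⟨h.5.symm, fun e => h.3 e.symm⟩)
      · exact SimpleGraph.Reachable.refl _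
    refine hX.linked_of_join h h' fun p hp q hq => ?_
    by_contra hn
    have h1 := near h p hp
    have h2 := near h' q hq
    by_cases e : p = q
    · exact hr (h1.trans (e ▸ h2.symm))
    · exact hr (h1.trans ((SimpleGraph.Adj.reachable
        ((SimpleGraph.compl_adj ..).2 ⟨e, hn⟩)).trans h2.symm))

end Subdivisions

/-! ### Graphs whose subdivisions are linked -/

section SubdivisionsLinked
variable {V : Type*}

/-- Exactly one of the three pairs in `{p, q, r}` is an edge of `X`, so the flip of this triangle
subdivides an edge. -/
def OneEdge (X : SimpleGraph V) (p q r : V) : Prop :=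
  Subdividable X p q r ∨ Subdividable X q r p ∨ Subdividable X r p q

theorem oneEdge_iff {X : SimpleGraph V} {p q r : V} : OneEdge X p q r ↔
    (p ≠ q ∧ q ≠ r ∧ r ≠ p) ∧ ((X.Adj p q ∧ ¬ X.Adj q r ∧ ¬ X.Adj r p) ∨
      (¬ X.Adj p q ∧ X.Adj q r ∧ ¬ X.Adj r p) ∨ (¬ X.Adj p q ∧ ¬ X.Adj q r ∧ X.Adj r p)) := by
  constructor
  · rintro (⟨h1, h2, h3, h4, h5⟩ | ⟨h1, h2, h3, h4, h5⟩ | ⟨h1, h2, h3, h4, h5⟩) <;>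
      have := h1.ne <;> grind [SimpleGraph.adj_comm]
  · rintro ⟨⟨h1, h2, h3⟩, ⟨h4, h5, h6⟩ | ⟨h4, h5, h6⟩ | ⟨h4, h5, h6⟩⟩
    · exact Or.inl ⟨h4, fun h => h6 h.symm, h5, h3.symm, h2⟩
    · exact Or.inr (Or.inl ⟨h5, fun h => h4 h.symm, h6, h1.symm, h3⟩)
    · exact Or.inr (Or.inr ⟨h6, fun h => h5 h.symm, h4, h2.symm, h1⟩)

theorem Subdividable.oneEdge {X : SimpleGraph V} {p q r : V} (h : Subdividable X p q r) :
    OneEdge X p q r := Or.inl h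

theorem OneEdge.exists_subdividable {X : SimpleGraph V} {p q r : V} (h : OneEdge X p q r) :
    ∃ a b u, Subdividable X a b u ∧ flipTri X a b u = flipTri X p q r := by
  rcases h with h | h | h
  · exact ⟨_, _, _, h, rfl⟩
  · exact ⟨_, _, _, h, flipTri_rotate _ _ _ _⟩
  · exact ⟨_, _, _, h, by rw [flipTri_rotate, flipTri_rotate]⟩

variable [Fintype V]

/-- All subdivisions of `X` are linked to all subdivisions of `X'`. This is vacuous if one of the
graphs has no subdivision, and so it is transitive only through graphs that have one. -/
def SubdivisionsLinked (X X' : SimpleGraph V) : Prop :=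
  ∀ ⦃a b u a' b' u' : V⦄, Subdividable X a b u → Subdividable X' a' b' u' →
    Linked Finset.univ (flipTri X a b u) (flipTri X' a' b' u')

variable {X X' X'' : SimpleGraph V}

theorem SubdivisionsLinked.symm (h : SubdivisionsLinked X X') : SubdivisionsLinked X' X :=
  fun _ _ _ _ _ _ h1 h2 => (h h2 h1).symm

theorem SubdivisionsLinked.trans (h : SubdivisionsLinked X X') (h' : SubdivisionsLinked X' X'')
    {a b u : V} (hs : Subdividable X' a b u) : SubdivisionsLinked X X'' :=
  fun _ _ _ _ _ _ h1 h2 => (h h1 hs).trans (h' hs h2)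

/-- A single link suffices, as all subdivisions of one graph are linked to each other. -/
theorem subdivisionsLinked_of_linked (hX : EulerianOn Finset.univ X)
    (hX' : EulerianOn Finset.univ X') {p q r p' q' r' : V}
    (h : OneEdge X p q r) (h' : OneEdge X' p' q' r')
    (hl : Linked Finset.univ (flipTri X p q r) (flipTri X' p' q' r')) :
    SubdivisionsLinked X X' := by
  obtain ⟨a, b, u, hs, e⟩ := h.exists_subdividable
  obtain ⟨a', b', u', hs', e'⟩ := h'.exists_subdividable
  rw [← e, ← e'] at hl
  exact fun _ _ _ _ _ _ h1 h2 =>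
    (hX.linked_flipTri h1 hs).trans (hl.trans (hX'.linked_flipTri hs' h2))

theorem subdivisionsLinked_of_flipQuad (hX : EulerianOn Finset.univ X)
    (hX' : EulerianOn Finset.univ X') (hm : numEdges X = numEdges X') {p q r p' q' r' : V}
    (h : OneEdge X p q r) (h' : OneEdge X' p' q' r') (x y z w : V) (hn : [x, y, z, w].Nodup)
    (e : flipTri X' p' q' r' = flipQuad (flipTri X p q r) x y z w) : SubdivisionsLinked X X' := by
  refine subdivisionsLinked_of_linked hX hX' h h' ?_
  obtain ⟨a, b, u, hs, e1⟩ := h.exists_subdividable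
  obtain ⟨a', b', u', hs', e2⟩ := h'.exists_subdividable
  rw [← e1, ← e2] at e ⊢
  exact linked_flipTri hX hX' hm hs hs' x y z w hn e

/-- If the same triangle yields a subdivision before and after the switch, then the two subdivisions
differ by this switch. -/
theorem subdivisionsLinked_of_oneEdge (hX : EulerianOn Finset.univ X) {x y z w : V}
    (hX' : EulerianOn Finset.univ (flipQuad X x y z w))
    (hm : numEdges X = numEdges (flipQuad X x y z w)) (hn : [x, y, z, w].Nodup)
    {p q r : V} (h : OneEdge X p q r) (h' : OneEdge (flipQuad X x y z w) p q r) :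
    SubdivisionsLinked X (flipQuad X x y z w) :=
  subdivisionsLinked_of_flipQuad hX hX' hm h h' x y z w hn (flipTri_flipQuad_comm _ _ _ _ _ _ _ _)

end SubdivisionsLinked

/-! ### Switches of two opposite edges -/

section Opposite
variable {V : Type*}

/-- Contrapositively, under `H`: if every outside vertex is adjacent to both or none of `x`, `y`
and to both or none of `z`, `w`, then a triangle with one edge still has one edge after the switch
of `y z`, `w x` to `x y`, `z w`. -/
theorem exists_of_oneEdge_opposite {X : SimpleGraph V} {x y z w : V} (hn : [x, y, z, w].Nodup)
    (hxy : ¬ X.Adj x y) (hyz : X.Adj y z) (hzw : ¬ X.Adj z w) (hwx : X.Adj w x)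
    (hxz : X.Adj x z) (hyw : X.Adj y w)
    (H : ∀ v, v ∉ [x, y, z, w] → (X.Adj v x ∨ X.Adj v z) ∧ (X.Adj v y ∨ X.Adj v w))
    {p q r : V} (h : OneEdge X p q r) (h' : ¬ OneEdge (flipQuad X x y z w) p q r) :
    ∃ v, v ∉ [x, y, z, w] ∧ (¬ (X.Adj v x ↔ X.Adj v y) ∨ ¬ (X.Adj v z ↔ X.Adj v w)) := by
  by_contra! hc
  refine h' ?_
  have hadj := flipQuad_adj X hn
  simp only [List.nodup_cons, List.mem_cons, List.not_mem_nil, or_false, not_or] at hn H hc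
  rw [oneEdge_iff] at h ⊢
  have Hp := H p
  have Hq := H q
  have Hr := H r
  have cp := hc p
  have cq := hc q
  have cr := hc r
  simp only [hadj]
  have s1 := X.adj_comm p q
  have s2 := X.adj_comm q r
  have s3 := X.adj_comm r p
  clear hadj h' H hc
  by_cases p = x <;> by_cases p = y <;> by_cases p = z <;> by_cases p = w <;> (try grind) <;>
  by_cases q = x <;> by_cases q = y <;> by_cases q = z <;> by_cases q = w <;> grind

variable [Fintype V] {X : SimpleGraph V}

set_option maxHeartbeats 1000000 in
/-- The switch of the edges `y z`, `w x` to `x y`, `z w`. If no two subdivisions of the graphs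
differ by the flip of a quadrilateral, an outside vertex misses no vertex of `x y z w` or two
consecutive ones. As `X` has a subdivision, some `v` misses `y`, `z` or `w`, `x`; as the other
graph has one, some `v'` misses `x`, `y` or `z`, `w`. These two form a triangle with one edge with
a vertex of the quadrilateral, and the switch does not affect this triangle. -/
theorem EulerianOn.subdivisionsLinked_opposite (hX : EulerianOn Finset.univ X) {x y z w : V}
    (hX' : EulerianOn Finset.univ (flipQuad X x y z w))
    (hm : numEdges X = numEdges (flipQuad X x y z w)) (hn : [x, y, z, w].Nodup)
    (hxy : ¬ X.Adj x y) (hyz : X.Adj y z) (hzw : ¬ X.Adj z w) (hwx : X.Adj w x)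
    {a b u a' b' u' : V} (h : Subdividable X a b u)
    (h' : Subdividable (flipQuad X x y z w) a' b' u') :
    SubdivisionsLinked X (flipQuad X x y z w) := by
  by_contra hS
  have hc : ∀ p q r, OneEdge X p q r → ¬ OneEdge (flipQuad X x y z w) p q r := fun p q r h1 h2 =>
    hS (subdivisionsLinked_of_oneEdge hX hX' hm hn h1 h2)
  have hadj := flipQuad_adj X hn
  have hadj2 : ∀ p q, p ∉ [x, y, z, w] → ((flipQuad X x y z w).Adj p q ↔ X.Adj p q) := by
    intro p q hp
    rw [hadj]; simp at hp; grind
  set X' := flipQuad X x y z w with hX'd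
  have hn' := hn
  simp only [List.nodup_cons, List.mem_cons, List.not_mem_nil, or_false, not_or] at hn'
  have hxz : X.Adj x z := by
    by_contra hxz
    refine hc x y z ?_ ?_ <;> rw [oneEdge_iff]
    · grind [SimpleGraph.adj_comm]
    · simp only [hadj]; grind [SimpleGraph.adj_comm]
  have hyw : X.Adj y w := by
    by_contra hyw
    refine hc y z w ?_ ?_ <;> rw [oneEdge_iff]
    · grind [SimpleGraph.adj_comm]
    · simp only [hadj]; grind [SimpleGraph.adj_comm]
  have H : ∀ v, v ∉ [x, y, z, w] → (X.Adj v x ∨ X.Adj v z) ∧ (X.Adj v y ∨ X.Adj v w) := by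
    intro v hv
    have e := hadj2 v
    simp only [List.mem_cons, List.not_mem_nil, or_false, not_or] at hv e
    constructor
    · by_contra hvv
      refine hc v x z ?_ ?_ <;> rw [oneEdge_iff]
      · grind [SimpleGraph.adj_comm]
      · simp only [hadj]; grind [SimpleGraph.adj_comm]
    · by_contra hvv
      refine hc v y w ?_ ?_ <;> rw [oneEdge_iff]
      · grind [SimpleGraph.adj_comm]
      · simp only [hadj]; grind [SimpleGraph.adj_comm]
  -- A vertex outside the quadrilateral misses no vertex of it, or two consecutive ones.
  have H1 : ∀ v, v ∉ [x, y, z, w] → (X.Adj v x ↔ X.Adj v y) ∧ (X.Adj v z ↔ X.Adj v w) ∨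
      (X.Adj v y ↔ X.Adj v z) ∧ (X.Adj v w ↔ X.Adj v x) := by
    intro v hv
    have hH := H v hv
    simp only [List.mem_cons, List.not_mem_nil, or_false, not_or] at hv
    have t1 : X.Adj v x ∨ ¬ X.Adj v y ∨ ¬ X.Adj v z ∨ ¬ X.Adj v w := by
      by_contra! hcon
      refine hS (subdivisionsLinked_of_flipQuad hX hX' hm (p := v) (q := x) (r := y) (p' := v)
        (q' := x) (r' := w) ?_ ?_ y v w z (by simp; grind) ?_)
      · rw [oneEdge_iff]; grind [SimpleGraph.adj_comm]
      · rw [oneEdge_iff]; simp only [hadj]; grind [SimpleGraph.adj_comm]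
      · simp [hX'd, flipTri, flipQuad, symmDiff_comm, symmDiff_left_comm, symmDiff_assoc,
          SimpleGraph.edge_comm]
    have t2 : ¬ X.Adj v x ∨ X.Adj v y ∨ ¬ X.Adj v z ∨ ¬ X.Adj v w := by
      by_contra! hcon
      refine hS (subdivisionsLinked_of_flipQuad hX hX' hm (p := v) (q := y) (r := x) (p' := v)
        (q' := y) (r' := z) ?_ ?_ x v z w (by simp; grind) ?_)
      · rw [oneEdge_iff]; grind [SimpleGraph.adj_comm]
      · rw [oneEdge_iff]; simp only [hadj]; grind [SimpleGraph.adj_comm]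
      · simp [hX'd, flipTri, flipQuad, symmDiff_comm, symmDiff_left_comm, symmDiff_assoc,
          SimpleGraph.edge_comm]
    have t3 : ¬ X.Adj v x ∨ ¬ X.Adj v y ∨ X.Adj v z ∨ ¬ X.Adj v w := by
      by_contra! hcon
      refine hS (subdivisionsLinked_of_flipQuad hX hX' hm (p := v) (q := z) (r := w) (p' := v)
        (q' := z) (r' := y) ?_ ?_ y v w x (by simp; grind) ?_)
      · rw [oneEdge_iff]; grind [SimpleGraph.adj_comm]
      · rw [oneEdge_iff]; simp only [hadj]; grind [SimpleGraph.adj_comm]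
      · simp [hX'd, flipTri, flipQuad, symmDiff_comm, symmDiff_left_comm, symmDiff_assoc,
          SimpleGraph.edge_comm]
    have t4 : ¬ X.Adj v x ∨ ¬ X.Adj v y ∨ ¬ X.Adj v z ∨ X.Adj v w := by
      by_contra! hcon
      refine hS (subdivisionsLinked_of_flipQuad hX hX' hm (p := v) (q := w) (r := z) (p' := v)
        (q' := w) (r' := x) ?_ ?_ x v z y (by simp; grind) ?_)
      · rw [oneEdge_iff]; grind [SimpleGraph.adj_comm]
      · rw [oneEdge_iff]; simp only [hadj]; grind [SimpleGraph.adj_comm]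
      · simp [hX'd, flipTri, flipQuad, symmDiff_comm, symmDiff_left_comm, symmDiff_assoc,
          SimpleGraph.edge_comm]
    clear hadj hadj2 H hc hS h h' hX hX' hm hX'd
    grind
  obtain ⟨v, hv, hvt⟩ := exists_of_oneEdge_opposite hn hxy hyz hzw hwx hxz hyw H h.oneEdge
    (hc _ _ _ h.oneEdge)
  have hback : flipQuad X' y z w x = X := by
    rw [flipQuad_rotate, hX'd, flipQuad_flipQuad]
  obtain ⟨v', hv', hvt'⟩ : ∃ v, v ∉ [y, z, w, x] ∧
      (¬ (X'.Adj v y ↔ X'.Adj v z) ∨ ¬ (X'.Adj v w ↔ X'.Adj v x)) := by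
    refine exists_of_oneEdge_opposite (X := X') (by simp; grind) ?_ ?_ ?_ ?_ ?_ ?_ ?_ h'.oneEdge ?_
    · rw [hadj]; grind
    · rw [hadj]; grind
    · rw [hadj]; grind
    · rw [hadj]; grind
    · rw [hadj]; grind
    · rw [hadj]; grind [SimpleGraph.adj_comm]
    · intro v hv
      have h1 : v ∉ [x, y, z, w] := by simp at hv ⊢; tauto
      simp only [hadj2 v _ h1]
      exact ⟨(H v h1).2, (H v h1).1.symm⟩
    · rw [hback]; exact fun h1 => hc _ _ _ h1 h'.oneEdge
  have hv'2 : v' ∉ [x, y, z, w] := by simp at hv' ⊢; tauto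
  simp only [hadj2 v' _ hv'2] at hvt'
  have hvv : v ≠ v' := by rintro rfl; have := H1 v hv; tauto
  have a1 := H v hv
  have a2 := H1 v hv
  have b1 := H v' hv'2
  have b2 := H1 v' hv'2
  -- The two exceptional vertices share exactly one nonneighbor on the quadrilateral.
  have key : ∀ p, p ≠ v → p ≠ v' → ¬ OneEdge X v v' p := by
    intro p h1 h2 h3
    refine hc v v' p h3 ?_
    rw [oneEdge_iff, X'.adj_comm p v, hadj2 v _ hv, hadj2 v _ hv, hadj2 v' _ hv'2,
      X.adj_comm v p, ← oneEdge_iff]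
    exact h3
  simp only [List.mem_cons, List.not_mem_nil, or_false, not_or] at hv hv'2
  have hcx := key x (Ne.symm hv.1) (Ne.symm hv'2.1)
  have hcy := key y (Ne.symm hv.2.1) (Ne.symm hv'2.2.1)
  have hcz := key z (Ne.symm hv.2.2.1) (Ne.symm hv'2.2.2.1)
  have hcw := key w (Ne.symm hv.2.2.2) (Ne.symm hv'2.2.2.2)
  simp only [oneEdge_iff, X.adj_comm x v, X.adj_comm y v, X.adj_comm z v, X.adj_comm w v]
    at hcx hcy hcz hcw
  clear hadj hadj2 H H1 hc hS h h' hX hX' hm hback hX'd key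
  by_cases X.Adj v v' <;> grind

end Opposite

/-! ### Switches of a path of two edges -/

section ReplacePath
variable {V : Type*}

/-- Contrapositively, under `H`: if every outside vertex is adjacent to both or none of `x`, `y`,
then a triangle with one edge still has one edge after the switch of the path `x w z` to `x y z`.
-/
theorem exists_of_oneEdge_adjacent {X : SimpleGraph V} {x y z w : V} (hn : [x, y, z, w].Nodup)
    (hxy : ¬ X.Adj x y) (hyz : ¬ X.Adj y z) (hzw : X.Adj z w) (hwx : X.Adj w x)
    (hxz : ¬ X.Adj x z) (hyw : X.Adj y w)
    (H : ∀ v, v ∉ [x, y, z, w] → (X.Adj v x ↔ X.Adj v z) ∧ (X.Adj v y ∨ X.Adj v w))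
    {p q r : V} (h : OneEdge X p q r) (h' : ¬ OneEdge (flipQuad X x y z w) p q r) :
    ∃ v, v ∉ [x, y, z, w] ∧ ¬ (X.Adj v x ↔ X.Adj v y) := by
  by_contra! hc
  refine h' ?_
  have hadj := flipQuad_adj X hn
  simp only [List.nodup_cons, List.mem_cons, List.not_mem_nil, or_false, not_or] at hn H hc
  rw [oneEdge_iff] at h ⊢
  have Hp := H p
  have Hq := H q
  have Hr := H r
  have cp := hc p
  have cq := hc q
  have cr := hc r
  simp only [hadj]
  have s1 := X.adj_comm p q
  have s2 := X.adj_comm q r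
  have s3 := X.adj_comm r p
  clear hadj h' H hc
  by_cases p = x <;> by_cases p = y <;> by_cases p = z <;> by_cases p = w <;> (try grind) <;>
  by_cases q = x <;> by_cases q = y <;> by_cases q = z <;> by_cases q = w <;> (try grind) <;>
  by_cases r = x <;> by_cases r = y <;> by_cases r = z <;> by_cases r = w <;>
  grind [SimpleGraph.adj_comm]

variable [Fintype V] {X : SimpleGraph V}

/-- The switch of the path `x w z` to `x y z` in the configuration where an outside vertex `v`
misses `y` but neither `x` nor `w`, an outside vertex `v'` misses `w` but not `x`, and `v v'` is an
edge. The subdivisions of `v x` by `y` before and of `v' x` by `w` after the switch are linked by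
two 2-switches. -/
theorem EulerianOn.subdivisionsLinked_of_pendant (hX : EulerianOn Finset.univ X) {x y z w v v' : V}
    (hX' : EulerianOn Finset.univ (flipQuad X x y z w))
    (hm : numEdges X = numEdges (flipQuad X x y z w)) (hn : [x, y, z, w].Nodup)
    (hv : v ∉ [x, y, z, w]) (hv' : v' ∉ [x, y, z, w])
    (hxy : ¬ X.Adj x y) (hwx : X.Adj w x)
    (hvx : X.Adj v x) (hvy : ¬ X.Adj v y) (hvw : X.Adj v w)
    (hv'x : X.Adj v' x) (hv'w : ¬ X.Adj v' w) (hvv' : X.Adj v v') :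
    SubdivisionsLinked X (flipQuad X x y z w) := by
  have hne := hvv'.ne
  have hn' := hn
  simp only [List.nodup_cons, List.mem_cons, List.not_mem_nil, or_false, not_or] at hn' hv hv'
  have s : Subdividable X v x y := ⟨hvx, hvy, hxy, hv.2.1, hn'.1.1⟩
  have s' : Subdividable (flipQuad X x y z w) v' x w := by
    refine ⟨?_, ?_, ?_, hv'.2.2.2, hn'.1.2.2⟩
    · rw [flipQuad_adj X hn]; grind
    · rw [flipQuad_adj X hn]; grind
    · rw [flipQuad_adj X hn]; grind [SimpleGraph.adj_comm]
  refine subdivisionsLinked_of_linked hX hX' s.oneEdge s'.oneEdge ?_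
  have d0 : [x, v, w, v'].Nodup := by simp; grind
  have d1 : [v, w, z, y].Nodup := by simp; grind
  have hadj := flipTri_adj X hvx.ne hn'.1.1 (Ne.symm hv.2.1)
  have hadj1 := flipQuad_adj (flipTri X v x y) d0
  have E0 := s.eulerianOn_univ hX
  have E2 := s'.eulerianOn_univ hX'
  have y1 : ¬ (flipTri X v x y).Adj x v := by rw [hadj]; grind [SimpleGraph.adj_comm]
  have y2 : (flipTri X v x y).Adj v w := by rw [hadj]; grind
  have y3 : ¬ (flipTri X v x y).Adj w v' := by rw [hadj]; grind [SimpleGraph.adj_comm]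
  have y4 : (flipTri X v x y).Adj v' x := by rw [hadj]; grind
  have y5 : (flipTri X v x y).Adj x w := by rw [hadj]; grind [SimpleGraph.adj_comm]
  have z1 : (flipQuad (flipTri X v x y) x v w v').Adj x v := by rw [hadj1]; grind
  have z2 : (flipQuad (flipTri X v x y) x v w v').Adj x w := by rw [hadj1]; grind
  have z3 : (flipQuad (flipTri X v x y) x v w v').Adj w v' := by rw [hadj1]; grind
  have E1 := E0.flipQuad_of_reachable d0 z1.reachable z2.reachable
    (z2.reachable.trans z3.reachable)
  have m1 : numEdges (flipQuad (flipTri X v x y) x v w v') = numEdges (flipTri X v x y) := by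
    rw [← flipQuad_rotate]
    exact numEdges_flipQuad_of_opposite (by simp; grind) y2 y3 y4 y1
  refine (linked_of_eq_flipQuad E0 E1 m1.symm d0 rfl).trans
    (linked_of_eq_flipQuad E1 E2 ?_ d1 ?_)
  · rw [m1, s.numEdges_eq, s'.numEdges_eq, hm]
  · simp [flipTri, flipQuad, symmDiff_comm, symmDiff_left_comm, symmDiff_assoc,
      SimpleGraph.edge_comm]

set_option maxHeartbeats 1000000 in
/-- The switch of the path `x w z` to `x y z`. If no two subdivisions of the graphs differ by the
flip of a quadrilateral, `x` and `z` are not adjacent and have the same outside neighbors. As `X`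
has a subdivision, some outside vertex `v` distinguishes `x` from `y`; as the other graph has one,
some `v'` distinguishes `x` from `w`. Unless these are as in
`EulerianOn.subdivisionsLinked_of_pendant`, they form a triangle with one edge with a vertex of the
quadrilateral, and the switch does not affect this triangle. -/
theorem EulerianOn.subdivisionsLinked_adjacent (hX : EulerianOn Finset.univ X) {x y z w : V}
    (hX' : EulerianOn Finset.univ (flipQuad X x y z w))
    (hm : numEdges X = numEdges (flipQuad X x y z w)) (hn : [x, y, z, w].Nodup)
    (hxy : ¬ X.Adj x y) (hyz : ¬ X.Adj y z) (hzw : X.Adj z w) (hwx : X.Adj w x)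
    {a b u a' b' u' : V} (h : Subdividable X a b u)
    (h' : Subdividable (flipQuad X x y z w) a' b' u') :
    SubdivisionsLinked X (flipQuad X x y z w) := by
  by_contra hS
  have hc : ∀ p q r, OneEdge X p q r → ¬ OneEdge (flipQuad X x y z w) p q r := fun p q r h1 h2 =>
    hS (subdivisionsLinked_of_oneEdge hX hX' hm hn h1 h2)
  have hadj := flipQuad_adj X hn
  have hadj2 : ∀ p q, p ∉ [x, y, z, w] → ((flipQuad X x y z w).Adj p q ↔ X.Adj p q) := by
    intro p q hp
    rw [hadj]; simp at hp; grind
  set X' := flipQuad X x y z w with hX'd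
  have hn' := hn
  simp only [List.nodup_cons, List.mem_cons, List.not_mem_nil, or_false, not_or] at hn'
  have hyw : X.Adj y w := by
    by_contra hyw
    refine hc y z w ?_ ?_ <;> rw [oneEdge_iff]
    · grind [SimpleGraph.adj_comm]
    · simp only [hadj]; grind [SimpleGraph.adj_comm]
  have hxz : ¬ X.Adj x z := by
    intro hxz
    have o1 : OneEdge X x y z := by rw [oneEdge_iff]; grind [SimpleGraph.adj_comm]
    have o2 : OneEdge X' x w z := by
      rw [oneEdge_iff]; simp only [hadj]; grind [SimpleGraph.adj_comm]
    refine hS (subdivisionsLinked_of_linked hX hX' o1 o2 ?_)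
    have e : flipTri X x y z = flipTri X' x w z := by
      simp [hX'd, flipTri, flipQuad, symmDiff_comm, symmDiff_left_comm, symmDiff_assoc,
        SimpleGraph.edge_comm]
    rw [e]; exact Linked.refl _
  have H : ∀ v, v ∉ [x, y, z, w] → (X.Adj v x ↔ X.Adj v z) ∧ (X.Adj v y ∨ X.Adj v w) := by
    intro v hv
    have e := hadj2 v
    simp only [List.mem_cons, List.not_mem_nil, or_false, not_or] at hv e
    constructor
    · by_contra hvv
      refine hc v x z ?_ ?_ <;> rw [oneEdge_iff]
      · grind [SimpleGraph.adj_comm]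
      · simp only [hadj]; grind [SimpleGraph.adj_comm]
    · by_contra hvv
      refine hc v y w ?_ ?_ <;> rw [oneEdge_iff]
      · grind [SimpleGraph.adj_comm]
      · simp only [hadj]; grind [SimpleGraph.adj_comm]
  have H1 : ∀ v, v ∉ [x, y, z, w] → X.Adj v x ∨ ¬ X.Adj v y ∨ ¬ X.Adj v w := by
    intro v hv
    have hH := H v hv
    simp only [List.mem_cons, List.not_mem_nil, or_false, not_or] at hv
    by_contra! hcon
    refine hS (subdivisionsLinked_of_flipQuad hX hX' hm (p := v) (q := x) (r := y) (p' := v)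
      (q' := x) (r' := w) ?_ ?_ y v w z (by simp; grind) ?_)
    · rw [oneEdge_iff]; grind [SimpleGraph.adj_comm]
    · rw [oneEdge_iff]; simp only [hadj]; grind [SimpleGraph.adj_comm]
    · simp [hX'd, flipTri, flipQuad, symmDiff_comm, symmDiff_left_comm, symmDiff_assoc,
        SimpleGraph.edge_comm]
  obtain ⟨v, hv, hvt⟩ := exists_of_oneEdge_adjacent hn hxy hyz hzw hwx hxz hyw H h.oneEdge
    (hc _ _ _ h.oneEdge)
  have hback : flipQuad X' x w z y = X := by
    rw [← flipQuad_reverse, ← flipQuad_rotate, ← flipQuad_rotate, hX'd, flipQuad_flipQuad]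
  obtain ⟨v', hv', hvt'⟩ : ∃ v, v ∉ [x, w, z, y] ∧ ¬ (X'.Adj v x ↔ X'.Adj v w) := by
    refine exists_of_oneEdge_adjacent (X := X') (by simp; grind) ?_ ?_ ?_ ?_ ?_ ?_ ?_ h'.oneEdge ?_
    · rw [hadj]; grind [SimpleGraph.adj_comm]
    · rw [hadj]; grind [SimpleGraph.adj_comm]
    · rw [hadj]; grind [SimpleGraph.adj_comm]
    · rw [hadj]; grind [SimpleGraph.adj_comm]
    · rw [hadj]; grind
    · rw [hadj]; grind [SimpleGraph.adj_comm]
    · intro v hv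
      have h1 : v ∉ [x, y, z, w] := by simp at hv ⊢; tauto
      simp only [hadj2 v _ h1]
      exact ⟨(H v h1).1, (H v h1).2.symm⟩
    · rw [hback]; exact fun h1 => hc _ _ _ h1 h'.oneEdge
  have hv'2 : v' ∉ [x, y, z, w] := by simp at hv' ⊢; tauto
  rw [hadj2 v' _ hv'2, hadj2 v' _ hv'2] at hvt'
  have a1 := H v hv
  have a2 := H1 v hv
  have b1 := H v' hv'2
  have b2 := H1 v' hv'2
  have hvv : v ≠ v' := by rintro rfl; clear hS hc hadj hadj2 H H1 hX'd; grind
  have key : ∀ p, p ≠ v → p ≠ v' → ¬ OneEdge X v v' p := by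
    intro p h1 h2 h3
    refine hc v v' p h3 ?_
    rw [oneEdge_iff, X'.adj_comm p v, hadj2 v _ hv, hadj2 v _ hv, hadj2 v' _ hv'2,
      X.adj_comm v p, ← oneEdge_iff]
    exact h3
  have hfin : X.Adj v x → ¬ X.Adj v y → X.Adj v w → X.Adj v' x → ¬ X.Adj v' w → X.Adj v v' →
      False := fun c1 c2 c3 c4 c5 c6 => hS (hX.subdivisionsLinked_of_pendant hX' hm hn hv hv'2
        hxy hwx c1 c2 c3 c4 c5 c6)
  simp only [List.mem_cons, List.not_mem_nil, or_false, not_or] at hv hv'2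
  have hcx := key x (Ne.symm hv.1) (Ne.symm hv'2.1)
  have hcy := key y (Ne.symm hv.2.1) (Ne.symm hv'2.2.1)
  have hcz := key z (Ne.symm hv.2.2.1) (Ne.symm hv'2.2.2.1)
  have hcw := key w (Ne.symm hv.2.2.2) (Ne.symm hv'2.2.2.2)
  simp only [oneEdge_iff, X.adj_comm x v, X.adj_comm y v, X.adj_comm z v, X.adj_comm w v]
    at hcx hcy hcz hcw
  clear hadj hadj2 H H1 hc hS h h' hX hX' hm hback hX'd key
  by_cases X.Adj v v' <;> grind

/-- Exactly two of the four pairs inverted by a 2-switch are edges. Up to a rotation of the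
quadrilateral they are opposite sides, or they are the path that is replaced. -/
theorem Move.exists_flipQuad {X X' : SimpleGraph V} (hM : Move Finset.univ X X') :
    ∃ x y z w, [x, y, z, w].Nodup ∧ X' = flipQuad X x y z w ∧ ¬ X.Adj x y ∧ X.Adj w x ∧
      ((¬ X.Adj y z ∧ X.Adj z w) ∨ (X.Adj y z ∧ ¬ X.Adj z w)) := by
  classical
  obtain ⟨-, -, hm, a, b, c, d, hn, rfl⟩ := hM
  have e := cast_numEdges_flipQuad X hn
  have r1 := flipQuad_rotate X a b c d
  have r2 := flipQuad_rotate X b c d a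
  have r3 := flipQuad_rotate X c d a b
  have n1 : [b, c, d, a].Nodup := by simp at hn ⊢; grind
  have n2 : [c, d, a, b].Nodup := by simp at hn ⊢; grind
  have n3 : [d, a, b, c].Nodup := by simp at hn ⊢; grind
  by_cases h1 : X.Adj a b <;> by_cases h2 : X.Adj b c <;> by_cases h3 : X.Adj c d <;>
    by_cases h4 : X.Adj d a <;> simp only [h1, h2, h3, h4, if_true, if_false] at e
  all_goals first
    | omega
    | exact ⟨a, b, c, d, hn, rfl, h1, h4, by tauto⟩
    | exact ⟨b, c, d, a, n1, r1.symm, h2, h1, by tauto⟩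
    | exact ⟨c, d, a, b, n2, (r2.trans r1).symm, h3, h2, by tauto⟩
    | exact ⟨d, a, b, c, n3, (r3.trans (r2.trans r1)).symm, h4, h3, by tauto⟩

/-- A 2-switch does not change the class of the subdivisions of a graph, provided that there are
subdivisions before and after it. -/
theorem Move.subdivisionsLinked {X X' : SimpleGraph V} (hM : Move Finset.univ X X')
    {a b u a' b' u' : V} (h : Subdividable X a b u) (h' : Subdividable X' a' b' u') :
    SubdivisionsLinked X X' := by
  obtain ⟨x, y, z, w, hn, rfl, hxy, hwx, ⟨hyz, hzw⟩ | ⟨hyz, hzw⟩⟩ := hM.exists_flipQuad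
  · exact hM.1.subdivisionsLinked_adjacent hM.2.1 hM.2.2.1 hn hxy hyz hzw hwx h h'
  · exact hM.1.subdivisionsLinked_opposite hM.2.1 hM.2.2.1 hn hxy hyz hzw hwx h h'

end ReplacePath

/-! ### Complete multipartite graphs and their 2-switches -/

section Multipartite
variable {V : Type*}

/-- Some edge of `X` can be subdivided by some vertex. This fails exactly for the complete
multipartite graphs. -/
def HasSubdivision (X : SimpleGraph V) : Prop := ∃ a b u, Subdividable X a b u

theorem OneEdge.hasSubdivision {X : SimpleGraph V} {p q r : V} (h : OneEdge X p q r) :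
    HasSubdivision X := by
  obtain ⟨a, b, u, hs, -⟩ := h.exists_subdividable
  exact ⟨a, b, u, hs⟩

variable {K : SimpleGraph V}

/-- In a complete multipartite graph nonadjacency is transitive. -/
theorem not_adj_trans (hK : ¬ HasSubdivision K) {a b c : V} (h1 : ¬ K.Adj a b)
    (h2 : ¬ K.Adj b c) : ¬ K.Adj a c := by
  intro h
  refine hK ⟨a, c, b, h, h1, fun h => h2 h.symm, ?_, ?_⟩
  · rintro rfl; exact h2 h
  · rintro rfl; exact h1 h

/-- `x`, `y`, `z` are distinct vertices of one part of the complete multipartite graph `K`, and `w`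
lies in another part: the path `x w z` can be replaced by `x y z`. -/
structure SamePart (K : SimpleGraph V) (x y z w : V) : Prop where
  xy : ¬ K.Adj x y
  yz : ¬ K.Adj y z
  wx : K.Adj w x
  ne_xy : x ≠ y
  ne_yz : y ≠ z
  ne_xz : x ≠ z

/-- `x`, `y` are distinct vertices of one part of the complete multipartite graph `K`, and `z`, `w`
are distinct vertices of another part: the edges `y z` and `w x` can be replaced by `x y` and
`z w`. -/
structure TwoParts (K : SimpleGraph V) (x y z w : V) : Prop where
  xy : ¬ K.Adj x y
  zw : ¬ K.Adj z w
  yz : K.Adj y z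
  ne_xy : x ≠ y
  ne_zw : z ≠ w

theorem SamePart.facts (hK : ¬ HasSubdivision K) {x y z w : V} (h : SamePart K x y z w) :
    [x, y, z, w].Nodup ∧ K.Adj z w ∧ K.Adj y w ∧ ¬ K.Adj x z := by
  obtain ⟨h1, h2, h3, h4, h5, h6⟩ := h
  have t1 := not_adj_trans hK h1 h2
  have t2 : K.Adj y w := by by_contra hn; exact not_adj_trans hK h1 hn h3.symm
  have t3 : K.Adj z w := by by_contra hn; exact not_adj_trans hK h2 hn t2
  have := h3.ne
  have := t2.ne
  have := t3.ne
  exact ⟨by simp; grind, t3, t2, t1⟩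

theorem TwoParts.facts (hK : ¬ HasSubdivision K) {x y z w : V} (h : TwoParts K x y z w) :
    [x, y, z, w].Nodup ∧ K.Adj w x ∧ K.Adj x z ∧ K.Adj y w := by
  obtain ⟨h1, h2, h3, h4, h5⟩ := h
  have t1 : K.Adj x z := by
    by_contra hn; exact not_adj_trans hK (fun e => h1 e.symm) hn h3
  have t2 : K.Adj y w := by
    by_contra hn; exact not_adj_trans hK hn (fun e => h2 e.symm) h3
  have t3 : K.Adj x w := by
    by_contra hn; exact not_adj_trans hK hn (fun e => h2 e.symm) t1
  have := h3.ne
  have := t1.ne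
  have := t2.ne
  have := t3.ne
  exact ⟨by simp; grind, t3.symm, t1, t2⟩

theorem TwoParts.swap (hK : ¬ HasSubdivision K) {x y z w : V} (h : TwoParts K x y z w) :
    TwoParts K z w x y := ⟨h.2, h.1, (h.facts hK).2.1, h.5, h.4⟩

theorem SamePart.replace (hK : ¬ HasSubdivision K) {x y z w z' : V} (h : SamePart K x y z w)
    (h1 : ¬ K.Adj x z') (h2 : z' ≠ x) (h3 : z' ≠ y) : SamePart K x y z' w :=
  ⟨h.1, not_adj_trans hK (fun e => h.1 e.symm) h1, h.3, h.4, Ne.symm h3, Ne.symm h2⟩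

theorem SamePart.swap (hK : ¬ HasSubdivision K) {x y z w : V} (h : SamePart K x y z w) :
    SamePart K y x z w :=
  ⟨fun e => h.1 e.symm, (h.facts hK).2.2.2, (h.facts hK).2.2.1.symm, h.4.symm, h.6, h.5⟩

theorem SamePart.reverse (hK : ¬ HasSubdivision K) {x y z w : V} (h : SamePart K x y z w) :
    SamePart K z y x w :=
  ⟨fun e => h.2 e.symm, fun e => h.1 e.symm, (h.facts hK).2.1.symm, h.5.symm, h.4.symm,
    h.6.symm⟩

/-- The switch leads to a graph with subdivisions unless the part of `w` is `{w}` and the part of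
`x` is `{x, y, z}`. -/
theorem SamePart.hasSubdivision_iff (hK : ¬ HasSubdivision K) {x y z w : V}
    (h : SamePart K x y z w) : HasSubdivision (flipQuad K x y z w) ↔
      (∃ w', w' ≠ w ∧ ¬ K.Adj w w') ∨ ∃ d, d ≠ x ∧ d ≠ y ∧ d ≠ z ∧ ¬ K.Adj x d := by
  obtain ⟨hn, f1, f2, f3⟩ := h.facts hK
  have hadj := flipQuad_adj K hn
  have tr := fun a b c => @not_adj_trans V K hK a b c
  obtain ⟨h1, h2, h3, h4, h5, h6⟩ := h
  simp only [List.nodup_cons, List.mem_cons, List.not_mem_nil, or_false, not_or] at hn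
  constructor
  · rintro ⟨a, b, u, ⟨k1, k2, k3, k4, k5⟩⟩
    by_contra! hc
    obtain ⟨c1, c2⟩ := hc
    have hab := k1.ne
    rw [hadj] at k1 k2 k3
    have wa := c1 a
    have wb := c1 b
    have wu := c1 u
    have da := c2 a
    have db := c2 b
    have du := c2 u
    have t1 := tr a u b
    have s1 := K.adj_comm a u
    have s2 := K.adj_comm b u
    have s3 := K.adj_comm a b
    have e1 := tr x y a
    have e2 := tr x y b
    have e3 := tr x y u
    have e4 := tr x z a
    have e5 := tr x z b
    have e6 := tr x z u
    clear hadj tr c1 c2 hK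
    by_cases u = x <;> by_cases u = y <;> by_cases u = z <;> by_cases u = w <;>
    by_cases a = x <;> by_cases a = y <;> by_cases a = z <;> by_cases a = w <;>
    grind [SimpleGraph.adj_comm]
  · rintro (⟨w', hw, hww⟩ | ⟨d, d1, d2, d3, d4⟩)
    · have e1 : K.Adj w' x := by by_contra hc; exact tr _ _ _ hww hc h3
      have e2 : w' ≠ y := by rintro rfl; exact h1 e1.symm
      have e3 : w' ≠ z := by rintro rfl; exact f3 e1.symm
      have e4 := e1.ne
      have : OneEdge (flipQuad K x y z w) w' x w := by
        rw [oneEdge_iff]; simp only [hadj]; clear hadj tr; grind [SimpleGraph.adj_comm]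
      exact this.hasSubdivision
    · have e1 : K.Adj d w := by by_contra hc; exact tr _ _ _ d4 hc h3.symm
      have e4 := e1.ne
      have : OneEdge (flipQuad K x y z w) d x w := by
        rw [oneEdge_iff]; simp only [hadj]; clear hadj tr; grind [SimpleGraph.adj_comm]
      exact this.hasSubdivision

/-- Whether the switch admits subdivisions afterwards depends on the part of `x` and on `w` only. -/
theorem SamePart.hasSubdivision_congr (hK : ¬ HasSubdivision K) {x y z w x' y' z' : V}
    (h : SamePart K x y z w) (h' : SamePart K x' y' z' w) (hx : ¬ K.Adj x x')
    (hS : HasSubdivision (flipQuad K x y z w)) : HasSubdivision (flipQuad K x' y' z' w) := by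
  rw [h.hasSubdivision_iff hK] at hS
  rw [h'.hasSubdivision_iff hK]
  rcases hS with hS | ⟨d, d1, d2, d3, d4⟩
  · exact Or.inl hS
  · right
    have hx' : ¬ K.Adj x' x := fun e => hx e.symm
    have e1 := not_adj_trans hK hx' h.xy
    have e2 := not_adj_trans hK e1 h.yz
    have e3 := not_adj_trans hK hx' d4
    obtain ⟨-, -, -, k1, k2, k3⟩ := h
    by_contra! hc
    have key : ∀ v, ¬ K.Adj x' v → v = x' ∨ v = y' ∨ v = z' := by
      intro v hv
      by_contra! hn
      exact hv (hc v hn.1 hn.2.1 hn.2.2)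
    have c1 := key x hx'
    have c2 := key y e1
    have c3 := key z e2
    have c4 := key d e3
    clear hc key hK
    grind

/-- If the switch leads to a graph with subdivisions, then one of the two parts has a third vertex.
-/
theorem TwoParts.exists_of_hasSubdivision (hK : ¬ HasSubdivision K) {x y z w : V}
    (h : TwoParts K x y z w) (hS : HasSubdivision (flipQuad K x y z w)) :
      (∃ d, d ≠ x ∧ d ≠ y ∧ ¬ K.Adj x d) ∨ ∃ d, d ≠ z ∧ d ≠ w ∧ ¬ K.Adj z d := by
  obtain ⟨hn, f1, f2, f3⟩ := h.facts hK
  have hadj := flipQuad_adj K hn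
  have tr := fun a b c => @not_adj_trans V K hK a b c
  obtain ⟨h1, h2, h3, h4, h5⟩ := h
  simp only [List.nodup_cons, List.mem_cons, List.not_mem_nil, or_false, not_or] at hn
  obtain ⟨a, b, u, ⟨k1, k2, k3, k4, k5⟩⟩ := hS
  by_contra! hc
  obtain ⟨c1, c2⟩ := hc
  have hab := k1.ne
  rw [hadj] at k1 k2 k3
  have wa := c1 a
  have wb := c1 b
  have wu := c1 u
  have da := c2 a
  have db := c2 b
  have du := c2 u
  have t1 := tr a u b
  have s1 := K.adj_comm a u
  have s2 := K.adj_comm b u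
  have s3 := K.adj_comm a b
  have e1 := tr x y a
  have e2 := tr x y b
  have e3 := tr x y u
  have e4 := tr z w a
  have e5 := tr z w b
  have e6 := tr z w u
  clear hadj tr c1 c2 hK
  by_cases u = x <;> by_cases u = y <;> by_cases u = z <;> by_cases u = w <;>
  by_cases a = x <;> by_cases a = y <;> by_cases a = z <;> by_cases a = w <;>
  grind [SimpleGraph.adj_comm]

variable [Fintype V]

theorem SamePart.move (hK : ¬ HasSubdivision K) (hE : EulerianOn Finset.univ K) {x y z w : V}
    (h : SamePart K x y z w) : Move Finset.univ K (flipQuad K x y z w) := by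
  obtain ⟨hn, f1, f2, f3⟩ := h.facts hK
  have hadj := flipQuad_adj K hn
  obtain ⟨h1, h2, h3, h4, h5, h6⟩ := h
  have hm : numEdges K = numEdges (flipQuad K x y z w) := by
    rw [← flipQuad_rotate, ← flipQuad_rotate]
    exact (numEdges_flipQuad_of_adjacent (by simp at hn ⊢; grind) f1 h3 h1 h2).symm
  simp only [List.nodup_cons, List.mem_cons, List.not_mem_nil, or_false, not_or] at hn
  have y1 : (flipQuad K x y z w).Adj x y := by rw [hadj]; grind
  have y2 : (flipQuad K x y z w).Adj y z := by rw [hadj]; grind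
  have y3 : (flipQuad K x y z w).Adj y w := by rw [hadj]; grind
  have hn2 : [x, y, z, w].Nodup := by simp; grind
  exact ⟨hE, hE.flipQuad_of_reachable hn2 y1.reachable (y1.reachable.trans y2.reachable)
    (y1.reachable.trans y3.reachable), hm, x, y, z, w, hn2, rfl⟩

theorem TwoParts.move (hK : ¬ HasSubdivision K) (hE : EulerianOn Finset.univ K) {x y z w : V}
    (h : TwoParts K x y z w) : Move Finset.univ K (flipQuad K x y z w) := by
  obtain ⟨hn, f1, f2, f3⟩ := h.facts hK
  have hadj := flipQuad_adj K hn
  obtain ⟨h1, h2, h3, h4, h5⟩ := h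
  have hm : numEdges K = numEdges (flipQuad K x y z w) := by
    rw [← flipQuad_rotate]
    exact (numEdges_flipQuad_of_opposite (by simp at hn ⊢; grind) h3 h2 f1 h1).symm
  simp only [List.nodup_cons, List.mem_cons, List.not_mem_nil, or_false, not_or] at hn
  have y1 : (flipQuad K x y z w).Adj x y := by rw [hadj]; grind
  have y2 : (flipQuad K x y z w).Adj x z := by rw [hadj]; grind
  have y3 : (flipQuad K x y z w).Adj z w := by rw [hadj]; grind
  have hn2 : [x, y, z, w].Nodup := by simp; grind
  exact ⟨hE, hE.flipQuad_of_reachable hn2 y1.reachable y2.reachable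
    (y2.reachable.trans y3.reachable), hm, x, y, z, w, hn2, rfl⟩

end Multipartite

/-! ### Graphs with linked subdivisions -/

section SameSubdivisions
variable {V : Type*} [Fintype V] {X Y Z K : SimpleGraph V}

/-- `X` and `Y` have subdivisions, and those of `X` are linked to those of `Y`. The graphs are then
said to have the same subdivisions. In contrast to `SubdivisionsLinked` this relation is
transitive. -/
structure SameSubdivisions (X Y : SimpleGraph V) : Prop where
  left : HasSubdivision X
  right : HasSubdivision Y
  linked : SubdivisionsLinked X Y

theorem SameSubdivisions.symm (h : SameSubdivisions X Y) : SameSubdivisions Y X :=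
  ⟨h.2, h.1, h.3.symm⟩

theorem SameSubdivisions.trans (h : SameSubdivisions X Y) (h' : SameSubdivisions Y Z) :
    SameSubdivisions X Z := by
  obtain ⟨_, _, _, hs⟩ := h.2
  exact ⟨h.1, h'.2, h.3.trans h'.3 hs⟩

theorem EulerianOn.sameSubdivisions (hX : EulerianOn Finset.univ X) (h : HasSubdivision X) :
    SameSubdivisions X X :=
  ⟨h, h, fun _ _ _ _ _ _ h1 h2 => hX.linked_flipTri h1 h2⟩

theorem Move.sameSubdivisions (hM : Move Finset.univ X Y) (h : HasSubdivision X)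
    (h' : HasSubdivision Y) : SameSubdivisions X Y := by
  obtain ⟨_, _, _, hs⟩ := id h
  obtain ⟨_, _, _, hs'⟩ := id h'
  exact ⟨h, h', hM.subdivisionsLinked hs hs'⟩

/-- Two graphs that arise from the same graph by 2-switches, and from each other by the flip of a
quadrilateral, have the same subdivisions. -/
theorem Move.sameSubdivisions_of_common (h1 : Move Finset.univ K X) (h2 : Move Finset.univ K Y)
    (hX : HasSubdivision X) (hY : HasSubdivision Y) {a b c d : V} (hn : [a, b, c, d].Nodup)
    (e : Y = flipQuad X a b c d) : SameSubdivisions X Y :=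
  Move.sameSubdivisions ⟨h1.2.1, h2.2.1, h1.2.2.1.symm.trans h2.2.2.1, a, b, c, d, hn, e⟩ hX hY

end SameSubdivisions

/-! ### Neighbors of a complete multipartite graph -/

section Neighbors
variable {V : Type*} [Fintype V] {K : SimpleGraph V}

theorem SamePart.sameSubdivisions_replace (hK : ¬ HasSubdivision K)
    (hE : EulerianOn Finset.univ K) {x y z w z' : V} (h : SamePart K x y z w)
    (h' : SamePart K x y z' w) (hS : HasSubdivision (flipQuad K x y z w))
    (hS' : HasSubdivision (flipQuad K x y z' w)) :
    SameSubdivisions (flipQuad K x y z w) (flipQuad K x y z' w) := by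
  by_cases e : z = z'
  · subst e; exact (h.move hK hE).2.1.sameSubdivisions hS
  · have n1 := (h.facts hK).1
    have n2 := (h'.facts hK).1
    refine (h.move hK hE).sameSubdivisions_of_common (h'.move hK hE) hS hS'
      (a := y) (b := z) (c := w) (d := z') (by simp at n1 n2 ⊢; grind) ?_
    simp [flipQuad, symmDiff_comm, symmDiff_left_comm, symmDiff_assoc, SimpleGraph.edge_comm]

theorem SamePart.sameSubdivisions_swap (hK : ¬ HasSubdivision K)
    (hE : EulerianOn Finset.univ K) {x y z w : V} (h : SamePart K x y z w)
    (hS : HasSubdivision (flipQuad K x y z w)) (hS' : HasSubdivision (flipQuad K y x z w)) :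
    SameSubdivisions (flipQuad K x y z w) (flipQuad K y x z w) := by
  have n1 := (h.facts hK).1
  refine (h.move hK hE).sameSubdivisions_of_common ((h.swap hK).move hK hE) hS hS'
    (a := y) (b := z) (c := x) (d := w) (by simp at n1 ⊢; grind) ?_
  simp [flipQuad, symmDiff_comm, symmDiff_left_comm, symmDiff_assoc, SimpleGraph.edge_comm]

theorem SamePart.sameSubdivisions_target (hK : ¬ HasSubdivision K)
    (hE : EulerianOn Finset.univ K) {x y z w w' : V} (h : SamePart K x y z w)
    (h' : SamePart K x y z w') (hS : HasSubdivision (flipQuad K x y z w))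
    (hS' : HasSubdivision (flipQuad K x y z w')) :
    SameSubdivisions (flipQuad K x y z w) (flipQuad K x y z w') := by
  by_cases e : w = w'
  · subst e; exact (h.move hK hE).2.1.sameSubdivisions hS
  · have n1 := (h.facts hK).1
    have n2 := (h'.facts hK).1
    refine (h.move hK hE).sameSubdivisions_of_common (h'.move hK hE) hS hS'
      (a := x) (b := w) (c := z) (d := w') (by simp at n1 n2 ⊢; grind) ?_
    simp [flipQuad, symmDiff_comm, symmDiff_left_comm, symmDiff_assoc, SimpleGraph.edge_comm]

theorem SamePart.sameSubdivisions_of_target_eq (hK : ¬ HasSubdivision K)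
    (hE : EulerianOn Finset.univ K) {x y z w x' y' z' : V} (h : SamePart K x y z w)
    (h' : SamePart K x' y' z' w) (hx : ¬ K.Adj x x') (hS : HasSubdivision (flipQuad K x y z w)) :
    SameSubdivisions (flipQuad K x y z w) (flipQuad K x' y' z' w) := by
  -- It suffices to permute the three vertices and to exchange the last one.
  have swap : ∀ {x y z}, SamePart K x y z w → HasSubdivision (flipQuad K x y z w) →
      SamePart K y x z w ∧ SameSubdivisions (flipQuad K x y z w) (flipQuad K y x z w) :=
    fun h hS => ⟨h.swap hK, h.sameSubdivisions_swap hK hE hS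
      (h.hasSubdivision_congr hK (h.swap hK) h.xy hS)⟩
  have rev : ∀ {x y z}, SamePart K x y z w → HasSubdivision (flipQuad K x y z w) →
      SamePart K z y x w ∧ SameSubdivisions (flipQuad K x y z w) (flipQuad K z y x w) := by
    intro x y z h hS
    refine ⟨h.reverse hK, ?_⟩
    rw [flipQuad_reverse K x y z w]
    exact (h.move hK hE).2.1.sameSubdivisions hS
  have last : ∀ {x y z z'}, SamePart K x y z w → HasSubdivision (flipQuad K x y z w) →
      ¬ K.Adj x z' → z' ≠ x → z' ≠ y →
      SamePart K x y z' w ∧ SameSubdivisions (flipQuad K x y z w) (flipQuad K x y z' w) := by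
    intro x y z z' h hS h1 h2 h3
    have h' := h.replace hK h1 h2 h3
    exact ⟨h', h.sameSubdivisions_replace hK hE h' hS
      (h.hasSubdivision_congr hK h' K.irrefl hS)⟩
  have hxy' := not_adj_trans hK hx h'.xy
  have hxz' := not_adj_trans hK hxy' h'.yz
  obtain ⟨y1, z1, s1, r1⟩ : ∃ y1 z1, SamePart K x' y1 z1 w ∧
      SameSubdivisions (flipQuad K x y z w) (flipQuad K x' y1 z1 w) := by
    by_cases e1 : x' = x
    · subst e1; exact ⟨y, z, h, (h.move hK hE).2.1.sameSubdivisions hS⟩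
    by_cases e2 : x' = y
    · subst e2; exact ⟨x, z, swap h hS⟩
    obtain ⟨a1, a2⟩ := last h hS hx e1 e2
    obtain ⟨b1, b2⟩ := rev a1 a2.right
    exact ⟨y, x, b1, a2.trans b2⟩
  have hxy2 : ¬ K.Adj x' y' := h'.xy
  have hxz2 : ¬ K.Adj x' z' := (h'.facts hK).2.2.2
  obtain ⟨z2, s2, r2⟩ : ∃ z2, SamePart K x' y' z2 w ∧
      SameSubdivisions (flipQuad K x y z w) (flipQuad K x' y' z2 w) := by
    by_cases e1 : y' = y1
    · subst e1; exact ⟨z1, s1, r1⟩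
    obtain ⟨a1, a2⟩ := last s1 r1.right hxy2 (Ne.symm h'.ne_xy) e1
    -- Now the triple is `x' y1 y'`, and `y1`, `y'` have to be exchanged.
    obtain ⟨b1, b2⟩ := swap a1 a2.right
    obtain ⟨c1, c2⟩ := rev b1 b2.right
    obtain ⟨d1, d2⟩ := swap c1 c2.right
    exact ⟨y1, d1, r1.trans (a2.trans (b2.trans (c2.trans d2)))⟩
  exact r2.trans (last s2 r2.right hxz2 (Ne.symm h'.ne_xz) (Ne.symm h'.ne_yz)).2

theorem SamePart.sameSubdivisions_of_not_adj (hK : ¬ HasSubdivision K)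
    (hE : EulerianOn Finset.univ K) {x y z w x' y' z' w' : V} (h : SamePart K x y z w)
    (h' : SamePart K x' y' z' w') (hx : ¬ K.Adj x x') (hS : HasSubdivision (flipQuad K x y z w))
    (hS' : HasSubdivision (flipQuad K x' y' z' w')) :
    SameSubdivisions (flipQuad K x y z w) (flipQuad K x' y' z' w') := by
  have hwx : K.Adj w' x := by
    by_contra hc; exact not_adj_trans hK hc hx h'.wx
  have h1 : SamePart K x y z w' := ⟨h.1, h.2, hwx, h.4, h.5, h.6⟩
  have hS1 := h'.hasSubdivision_congr hK h1 (fun e => hx e.symm) hS'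
  exact (h.sameSubdivisions_target hK hE h1 hS hS1).trans
    (h1.sameSubdivisions_of_target_eq hK hE h' hx hS1)

/-- A switch between two parts of `K`, one of which has a third vertex `e`, has a subdivision in
common with a switch of a path in that part. -/
theorem TwoParts.sameSubdivisions_samePart (hK : ¬ HasSubdivision K)
    (hE : EulerianOn Finset.univ K) {x y z w e : V} (h : TwoParts K x y z w) (he : ¬ K.Adj x e)
    (hex : e ≠ x) (hey : e ≠ y) : SamePart K y x e z ∧
      SameSubdivisions (flipQuad K x y z w) (flipQuad K y x e z) := by
  obtain ⟨hn, f1, f2, f3⟩ := h.facts hK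
  have hP : SamePart K y x e z :=
    ⟨fun e => h.1 e.symm, he, h.3.symm, h.4.symm, hex.symm, hey.symm⟩
  obtain ⟨hn', g1, g2, g3⟩ := hP.facts hK
  have hadj := flipQuad_adj K hn
  have hadj' := flipQuad_adj K hn'
  have g4 : K.Adj e w := by
    by_contra hc; exact not_adj_trans hK he hc f1.symm
  have g5 := g4.ne
  have h2 := h.2
  simp only [List.nodup_cons, List.mem_cons, List.not_mem_nil, or_false, not_or] at hn hn'
  have o1 : OneEdge (flipQuad K x y z w) e x w := by
    rw [oneEdge_iff]; simp only [hadj]; clear hadj hadj' hK; grind [SimpleGraph.adj_comm]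
  have o2 : OneEdge (flipQuad K y x e z) e z w := by
    rw [oneEdge_iff]; simp only [hadj']; clear hadj hadj' hK; grind [SimpleGraph.adj_comm]
  refine ⟨hP, o1.hasSubdivision, o2.hasSubdivision, subdivisionsLinked_of_linked
    (h.move hK hE).2.1 (hP.move hK hE).2.1 o1 o2 ?_⟩
  have e1 : flipTri (flipQuad K x y z w) e x w = flipTri (flipQuad K y x e z) e z w := by
    simp [flipTri, flipQuad, symmDiff_comm, symmDiff_left_comm, symmDiff_assoc,
      SimpleGraph.edge_comm]
  rw [e1]; exact Linked.refl _

theorem Move.samePart_or_twoParts {X : SimpleGraph V}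
    (hM : Move Finset.univ K X) : ∃ x y z w, X = flipQuad K x y z w ∧
      (SamePart K x y z w ∨ TwoParts K x y z w) := by
  obtain ⟨x, y, z, w, hn, hX, hxy, hwx, ⟨hyz, hzw⟩ | ⟨hyz, hzw⟩⟩ := hM.exists_flipQuad
  all_goals
    simp only [List.nodup_cons, List.mem_cons, List.not_mem_nil, or_false, not_or] at hn
  · exact ⟨x, y, z, w, hX, Or.inl ⟨hxy, hyz, hwx, hn.1.1, hn.2.1.1, hn.1.2.1⟩⟩
  · exact ⟨x, y, z, w, hX, Or.inr ⟨hxy, hzw, hyz, hn.1.1, hn.2.2.1⟩⟩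

/-- Up to linked subdivisions, every neighbor of `K` with subdivisions comes from a switch of a path
with both ends in one part. -/
theorem Move.exists_samePart (hK : ¬ HasSubdivision K) (hE : EulerianOn Finset.univ K)
    {X : SimpleGraph V} (hM : Move Finset.univ K X) (hX : HasSubdivision X) :
    ∃ x y z w, SamePart K x y z w ∧ SameSubdivisions X (flipQuad K x y z w) := by
  obtain ⟨x, y, z, w, rfl, h | h⟩ := hM.samePart_or_twoParts
  · exact ⟨x, y, z, w, h, hM.2.1.sameSubdivisions hX⟩
  · rcases h.exists_of_hasSubdivision hK hX with ⟨e, h1, h2, h3⟩ | ⟨e, h1, h2, h3⟩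
    · exact ⟨_, _, _, _, h.sameSubdivisions_samePart hK hE h3 h1 h2⟩
    · have := (h.swap hK).sameSubdivisions_samePart hK hE h3 h1 h2
      rw [flipQuad_rotate, flipQuad_rotate] at this
      exact ⟨_, _, _, _, this⟩

/-- All graphs with subdivisions that arise by a 2-switch from the same complete multipartite graph
have the same subdivisions. -/
theorem Move.sameSubdivisions_of_multipartite (hK : ¬ HasSubdivision K) {X Y : SimpleGraph V}
    (h1 : Move Finset.univ K X) (h2 : Move Finset.univ K Y) (hX : HasSubdivision X)
    (hY : HasSubdivision Y) : SameSubdivisions X Y := by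
  have hE := h1.1
  obtain ⟨x, y, z, w, hP, r⟩ := h1.exists_samePart hK hE hX
  obtain ⟨x', y', z', w', hP', r'⟩ := h2.exists_samePart hK hE hY
  refine r.trans (SameSubdivisions.trans ?_ r'.symm)
  by_cases hx : K.Adj x x'
  · have hyx : K.Adj y x' := by
      by_contra hc; exact not_adj_trans hK hP.xy hc hx
    -- A switch between the two parts is compared with both sides.
    have hT : TwoParts K x y x' y' := ⟨hP.1, hP'.1, hyx, hP.4, hP'.4⟩
    obtain ⟨p1, q1⟩ := hT.sameSubdivisions_samePart hK hE (hP.facts hK).2.2.2 hP.6.symm hP.5.symm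
    obtain ⟨p2, q2⟩ := (hT.swap hK).sameSubdivisions_samePart hK hE (hP'.facts hK).2.2.2
      hP'.6.symm hP'.5.symm
    rw [flipQuad_rotate, flipQuad_rotate] at q2
    exact (hP.sameSubdivisions_of_not_adj hK hE p1 hP.xy r.right q1.right).trans
      (q1.symm.trans (q2.trans (p2.sameSubdivisions_of_not_adj hK hE hP'
        (fun e => hP'.xy e.symm) q2.right r'.right)))
  · exact hP.sameSubdivisions_of_not_adj hK hE hP' hx r.right r'.right

end Neighbors

/-! ### Sequences of 2-switches lift to subdivisions -/

section Chain
variable {V : Type*} [Fintype V] {K K' : SimpleGraph V}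

/-- Two complete multipartite graphs that arise from each other by a 2-switch have neighbors with
the same subdivisions. -/
theorem Move.exists_sameSubdivisions (hM : Move Finset.univ K K') (hK : ¬ HasSubdivision K)
    (hK' : ¬ HasSubdivision K') {Z : SimpleGraph V} (hZ : Move Finset.univ K Z)
    (hSZ : HasSubdivision Z) :
    ∃ X X', Move Finset.univ K X ∧ Move Finset.univ K' X' ∧ SameSubdivisions X X' := by
  have hE := hM.1
  obtain ⟨p, q, r, s, hP, hr⟩ := hZ.exists_samePart hK hE hSZ
  have hSP := hr.right
  obtain ⟨hnP, fP1, fP2, fP3⟩ := hP.facts hK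
  obtain ⟨x, y, z, w, rfl, h | h⟩ := hM.samePart_or_twoParts
  · obtain ⟨hn, f1, f2, f3⟩ := h.facts hK
    have hno := fun hc => hK' ((h.hasSubdivision_iff hK).2 hc)
    -- The part of `x` is `{x, y, z}`, the part of `w` is `{w}`; some other part has two vertices.
    obtain ⟨v, v', hxv, hvw, hvv, hadj⟩ : ∃ v v', K.Adj x v ∧ v ≠ w ∧ v' ≠ v ∧ ¬ K.Adj v v' := by
      have hw : ∀ v, ¬ K.Adj w v → v = w := fun v hv => by
        by_contra hc; exact hno (Or.inl ⟨v, hc, hv⟩)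
      by_cases hxp : K.Adj x p
      · refine ⟨p, q, hxp, ?_, hP.ne_xy.symm, hP.xy⟩
        rintro rfl
        exact hP.ne_xy (hw q hP.xy).symm
      · have hx : ∀ v, ¬ K.Adj x v → v = x ∨ v = y ∨ v = z := fun v hv => by
          by_contra! hc; exact hno (Or.inr ⟨v, hc.1, hc.2.1, hc.2.2, hv⟩)
        have c1 := hx p hxp
        have c2 := hx q (not_adj_trans hK hxp hP.xy)
        have c3 := hx r (not_adj_trans hK hxp fP3)
        rcases (hP.hasSubdivision_iff hK).1 hSP with ⟨s', hs1, hs2⟩ | ⟨d, d1, d2, d3, d4⟩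
        · refine ⟨s, s', ?_, ?_, hs1, hs2⟩
          · by_contra hc
            exact not_adj_trans hK (fun e => hc e.symm) hxp hP.wx
          · rintro rfl; exact hs1 (hw s' hs2)
        · exfalso
          have c4 := hx d (not_adj_trans hK hxp d4)
          obtain ⟨-, -, -, k1, k2, k3⟩ := hP
          clear hno hx hw hK hK'
          grind
    have h2 : SamePart K x y z v := ⟨h.1, h.2, hxv.symm, h.4, h.5, h.6⟩
    have hM2 := h2.move hK hE
    have hS2 := (h2.hasSubdivision_iff hK).2 (Or.inl ⟨v', hvv, hadj⟩)
    have hn2 := (h2.facts hK).1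
    refine ⟨_, _, hM2, ⟨hM.2.1, hM2.2.1, hM.2.2.1.symm.trans hM2.2.2.1, x, w, z, v, ?_, ?_⟩,
      hM2.2.1.sameSubdivisions hS2⟩
    · simp at hn hn2 ⊢; grind
    · simp [flipQuad, symmDiff_comm, symmDiff_left_comm, symmDiff_assoc, SimpleGraph.edge_comm]
  · obtain ⟨hn, f1, f2, f3⟩ := h.facts hK
    have hadj := flipQuad_adj K hn
    -- The parts involved are `{x, y}` and `{z, w}`, so the part of `p`, `q`, `r` is a third one.
    have hx : ∀ v, ¬ K.Adj x v → v = x ∨ v = y := fun v hv => by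
      by_contra! hc
      exact hK' (h.sameSubdivisions_samePart hK hE hv hc.1 hc.2).2.left
    have hz : ∀ v, ¬ K.Adj z v → v = z ∨ v = w := fun v hv => by
      by_contra! hc
      have := ((h.swap hK).sameSubdivisions_samePart hK hE hv hc.1 hc.2).2.left
      rw [flipQuad_rotate, flipQuad_rotate] at this
      exact hK' this
    have hxp : K.Adj x p := by
      by_contra hc
      have c1 := hx p hc
      have c2 := hx q (not_adj_trans hK hc hP.xy)
      have c3 := hx r (not_adj_trans hK hc fP3)
      have := hP.ne_xy; have := hP.ne_xz; have := hP.ne_yz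
      clear hx hz hK hK'
      grind
    have hzp : K.Adj z p := by
      by_contra hc
      have c1 := hz p hc
      have c2 := hz q (not_adj_trans hK hc hP.xy)
      have c3 := hz r (not_adj_trans hK hc fP3)
      have := hP.ne_xy; have := hP.ne_xz; have := hP.ne_yz
      clear hx hz hK hK'
      grind
    have h2 : SamePart K p q r x := ⟨hP.1, hP.2, hxp, hP.4, hP.5, hP.6⟩
    have hM2 := h2.move hK hE
    have hS2 := (h2.hasSubdivision_iff hK).2 (Or.inl ⟨y, h.ne_xy.symm, h.xy⟩)
    have off : ∀ v, ¬ K.Adj p v → v ∉ [x, y, z, w] := by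
      intro v hv hmem
      simp only [List.mem_cons, List.not_mem_nil, or_false] at hmem
      rcases hmem with rfl | rfl | rfl | rfl
      · exact hv hxp.symm
      · exact not_adj_trans hK hv (fun e => h.xy e.symm) hxp.symm
      · exact hv hzp.symm
      · exact not_adj_trans hK hv (fun e => h.zw e.symm) hzp.symm
    have op := off p K.irrefl
    have oq := off q hP.xy
    have hadj2 : ∀ v u, v ∉ [x, y, z, w] → ((flipQuad K x y z w).Adj v u ↔ K.Adj v u) := by
      intro v u hv
      rw [hadj]; simp at hv; clear hx hz off; grind
    have h3 : SamePart (flipQuad K x y z w) p q r x := by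
      refine ⟨?_, ?_, ?_, hP.4, hP.5, hP.6⟩
      · rw [hadj2 _ _ op]; exact hP.1
      · rw [hadj2 _ _ oq]; exact hP.2
      · rw [SimpleGraph.adj_comm, hadj2 _ _ op]; exact hxp.symm
    have hM3 := h3.move hK' hM.2.1
    have hn' := hn
    simp only [List.nodup_cons, List.mem_cons, List.not_mem_nil, or_false, not_or] at hn'
    have hS3 := (h3.hasSubdivision_iff hK').2 (Or.inl ⟨w, Ne.symm hn'.1.2.2, by
      rw [hadj]; clear hx hz off; grind [SimpleGraph.adj_comm]⟩)
    refine ⟨_, _, hM2, hM3, Move.sameSubdivisions ⟨hM2.2.1, hM3.2.1,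
      hM2.2.2.1.symm.trans (hM.2.2.1.trans hM3.2.2.1), x, y, z, w, hn, ?_⟩ hS2 hS3⟩
    simp [flipQuad, symmDiff_comm, symmDiff_left_comm, symmDiff_assoc, SimpleGraph.edge_comm]

/-- `Y` is linked to a subdivision of `X` or, if `X` is complete multipartite and hence has no
subdivisions, to a subdivision of a graph that arises from `X` by a 2-switch. -/
def LinkedAbove (X Y : SimpleGraph V) : Prop :=
  (∃ a b u, Subdividable X a b u ∧ Linked Finset.univ (flipTri X a b u) Y) ∨
    (¬ HasSubdivision X ∧ ∃ Z, Move Finset.univ X Z ∧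
      ∃ a b u, Subdividable Z a b u ∧ Linked Finset.univ (flipTri Z a b u) Y)

/-- The property `LinkedAbove` is invariant under 2-switches of the first graph. -/
theorem LinkedAbove.of_move {X X' Y : SimpleGraph V} (h : LinkedAbove X Y)
    (hM : Move Finset.univ X X') : LinkedAbove X' Y := by
  by_cases hX' : HasSubdivision X'
  · obtain ⟨a', b', u', hs'⟩ := id hX'
    refine Or.inl ⟨a', b', u', hs', ?_⟩
    rcases h with ⟨a, b, u, hs, hl⟩ | ⟨hX, Z, hZ, a, b, u, hs, hl⟩
    · exact (hM.subdivisionsLinked hs hs' hs hs').symm.trans hl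
    · exact ((hZ.sameSubdivisions_of_multipartite hX hM ⟨_, _, _, hs⟩ hX').linked hs
        hs').symm.trans hl
  · refine Or.inr ⟨hX', ?_⟩
    rcases h with ⟨a, b, u, hs, hl⟩ | ⟨hX, Z, hZ, a, b, u, hs, hl⟩
    · exact ⟨X, hM.symm, a, b, u, hs, hl⟩
    · obtain ⟨W, W', hW, hW', hWW⟩ := hM.exists_sameSubdivisions hX hX' hZ ⟨_, _, _, hs⟩
      obtain ⟨a', b', u', hs'⟩ := hWW.right
      have hZW := hZ.sameSubdivisions_of_multipartite hX hW ⟨_, _, _, hs⟩ hWW.left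
      exact ⟨W', hW', a', b', u', hs', ((hZW.trans hWW).linked hs hs').symm.trans hl⟩

/-- Subdivisions of linked graphs are linked. -/
theorem Linked.flipTri {X X' : SimpleGraph V} (h : Linked Finset.univ X X') {a b u a' b' u' : V}
    (hs : Subdividable X a b u) (hs' : Subdividable X' a' b' u')
    (hX' : EulerianOn Finset.univ X') :
    Linked Finset.univ (flipTri X a b u) (flipTri X' a' b' u') := by
  have key : LinkedAbove X' (_root_.flipTri X a b u) := by
    clear hs' hX'
    induction h with
    | refl => exact Or.inl ⟨a, b, u, hs, Linked.refl _⟩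
    | tail _ hM ih => exact ih.of_move hM
  rcases key with ⟨c, d, v, hs2, hl⟩ | ⟨hno, -⟩
  · exact hl.symm.trans (hX'.linked_flipTri hs2 hs')
  · exact absurd ⟨_, _, _, hs'⟩ hno

end Chain

/-! ### The induction on the number of edges -/

section Sequences
variable {V : Type*} [Fintype V]

theorem numEdges_lt_of_ne_top {G : SimpleGraph V} (h : G ≠ ⊤) :
    numEdges G < numEdges (⊤ : SimpleGraph V) := by
  rw [numEdges_eq_ncard, numEdges_eq_ncard]
  exact Set.ncard_lt_ncard (SimpleGraph.edgeSet_ssubset_edgeSet.2 (lt_top_iff_ne_top.2 h))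
    (Set.toFinite _)

/-- Any two Eulerian graphs on the same vertices with the same number of edges are linked. -/
theorem EulerianOn.linked {G H : SimpleGraph V} (hG : EulerianOn Finset.univ G)
    (hH : EulerianOn Finset.univ H) (hm : numEdges G = numEdges H) :
    Linked Finset.univ G H := by
  classical
  induction hk : numEdges G generalizing G H with
  | zero => exact hG.linked_of_numEdges_le hH (by omega) (by omega)
  | succ k ih =>
    by_cases hGt : G = ⊤
    · have : H = G := by
        by_contra hne
        have := numEdges_lt_of_ne_top (hGt ▸ hne)
        rw [← hGt] at this
        omega
      rw [this]; exact Linked.refl _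
    have hHt : H ≠ ⊤ := by
      rintro rfl
      have := numEdges_lt_of_ne_top hGt
      omega
    by_cases hle : numEdges G ≤ (Finset.univ : Finset V).card
    · exact hG.linked_of_numEdges_le hH hle (by omega)
    -- With more edges than vertices, some degree exceeds two.
    have hdeg : ∀ {F : SimpleGraph V}, EulerianOn Finset.univ F →
        ¬ numEdges F ≤ (Finset.univ : Finset V).card → ∃ u, 4 ≤ F.degree u := by
      intro F hF hF2
      by_contra! hlt
      have h2 : ∀ v, F.degree v ≤ 2 := by
        intro v
        have h3 := hlt v
        obtain ⟨r, hr⟩ := hF.even_degree v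
        omega
      have h4 := Finset.sum_le_sum (fun v (_ : v ∈ (Finset.univ : Finset V)) => h2 v)
      rw [sum_degree_eq] at h4
      simp only [Finset.sum_const, smul_eq_mul] at h4
      omega
    obtain ⟨u, hu⟩ := hdeg hG hle
    obtain ⟨u', hu'⟩ := hdeg hH (by omega)
    obtain ⟨X, a, b, v, hX, hs, rfl⟩ := hG.exists_eq_flipTri hGt hu
    obtain ⟨X', a', b', v', hX', hs', rfl⟩ := hH.exists_eq_flipTri hHt hu'
    have e1 := hs.numEdges_eq
    have e2 := hs'.numEdges_eq
    exact (ih hX hX' (by omega) (by omega)).flipTri hs hs' hX'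

theorem isEulerianGraph_iff {G : SimpleGraph V} :
    IsEulerianGraph G ↔ Nonempty V ∧ EulerianOn Finset.univ G := by
  classical
  constructor
  · rintro ⟨hc, hd⟩
    refine ⟨hc.nonempty, fun v => ?_, fun _ _ _ => Finset.mem_univ _,
      fun v _ w _ => hc.preconnected v w⟩
    rw [degParity_eq, ZMod.natCast_eq_zero_iff_even]
    convert hd v
  · rintro ⟨hne, h⟩
    refine ⟨⟨fun v w => h.reach v (Finset.mem_univ _) w (Finset.mem_univ _)⟩, fun v => ?_⟩
    convert h.even_degree v

theorem Move.isSwitch {G H : SimpleGraph V} (h : Move Finset.univ G H) : IsSwitch 2 G H := by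
  obtain ⟨-, -, hm, a, b, c, d, hn, e⟩ := h
  exact isSwitch_of_flipQuad hn e hm

theorem Linked.exists_sequence [Nonempty V] {G H : SimpleGraph V} (h : Linked Finset.univ G H)
    (hG : EulerianOn Finset.univ G) :
    ∃ (ℓ : ℕ) (Γ : Fin (ℓ + 1) → SimpleGraph V), Γ 0 = G ∧ Γ (Fin.last ℓ) = H ∧
      (∀ i : Fin (ℓ + 1), IsEulerianGraph (Γ i)) ∧
      (∀ i : Fin ℓ, IsSwitch 2 (Γ i.castSucc) (Γ i.succ)) := by
  induction h with
  | refl => exact ⟨0, fun _ => G, rfl, rfl, fun _ => isEulerianGraph_iff.2 ⟨‹_›, hG⟩,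
      fun i => i.elim0⟩
  | @tail X Y _ hM ih =>
    obtain ⟨ℓ, Γ, h0, hl, hE, hS⟩ := ih
    refine ⟨ℓ + 1, Fin.snoc Γ Y, ?_, ?_, fun i => ?_, fun i => ?_⟩
    · rw [← Fin.castSucc_zero, Fin.snoc_castSucc, h0]
    · rw [Fin.snoc_last]
    · refine Fin.lastCases ?_ (fun j => ?_) i
      · rw [Fin.snoc_last]; exact isEulerianGraph_iff.2 ⟨‹_›, hM.2.1⟩
      · rw [Fin.snoc_castSucc]; exact hE j
    · refine Fin.lastCases ?_ (fun j => ?_) i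
      · rw [Fin.snoc_castSucc, Fin.succ_last, Fin.snoc_last, hl]; exact hM.isSwitch
      · rw [Fin.snoc_castSucc, Fin.succ_castSucc, Fin.snoc_castSucc]; exact hS j

theorem Linked.reachable {m : ℕ} {G H : SimpleGraph V} (h : Linked Finset.univ G H)
    (hG : IsEulerianGraph G ∧ numEdges G = m) (hH : IsEulerianGraph H ∧ numEdges H = m) :
    (twoSwitchGraph V m).Reachable ⟨G, hG⟩ ⟨H, hH⟩ := by
  induction h with
  | refl => exact SimpleGraph.Reachable.refl _
  | @tail X Y _ hM ih =>
    have hX : IsEulerianGraph X ∧ numEdges X = m :=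
      ⟨isEulerianGraph_iff.2 ⟨hG.1.1.nonempty, hM.1⟩, hM.2.2.1.trans hH.2⟩
    exact (ih hX).trans (SimpleGraph.Adj.reachable (by exact hM.isSwitch))

end Sequences

theorem theorem2 {V : Type*} [Fintype V] (m : ℕ) :
    (∀ G H : SimpleGraph V, IsEulerianGraph G → IsEulerianGraph H →
      numEdges G = m → numEdges H = m →
      ∃ (ℓ : ℕ) (Γ : Fin (ℓ + 1) → SimpleGraph V),
        Γ 0 = G ∧ Γ (Fin.last ℓ) = H ∧
        (∀ i : Fin (ℓ + 1), IsEulerianGraph (Γ i)) ∧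
        (∀ i : Fin ℓ, IsSwitch 2 (Γ i.castSucc) (Γ i.succ))) ∧
    (Nonempty {G : SimpleGraph V // IsEulerianGraph G ∧ numEdges G = m} →
      (twoSwitchGraph V m).Connected) := by
  refine ⟨fun G H hG hH hmG hmH => ?_, fun hne => ⟨fun G H => ?_⟩⟩
  · obtain ⟨hV, hG⟩ := isEulerianGraph_iff.1 hG
    exact (hG.linked (isEulerianGraph_iff.1 hH).2 (hmG.trans hmH.symm)).exists_sequence hG
  · obtain ⟨G, hG⟩ := G
    obtain ⟨H, hH⟩ := H
    exact ((isEulerianGraph_iff.1 hG.1).2.linked (isEulerianGraph_iff.1 hH.1).2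
      (hG.2.trans hH.2.symm)).reachable hG hH
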